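/- Let $\pi:S^5\to\mathbb{C}P^2=S^5/S^1$ be the Hopf map, let $\mathbb{C}P^2$ carry the Fubini--Study Hermitian metric $\langle\cdot,\cdot\rangle-i\omega$ for which $d\pi_z:z^{\perp}\to T_{\pi(z)}\mathbb{C}P^2$ is a Hermitian isometry for every $z\in S^5$, and let $J$ be its complex structure. Let $S^1=\mathbb{R}/2\pi\mathbb{Z}$. A *homogeneous Hamiltonian stationary Lagrangian torus* is a smooth Lagrangian immersion $u:S^1\times S^1\to\mathbb{C}P^2$ (so $u^*\omega=0$) such that - $u$ is Hamiltonian stationary: $\int_{S^1\times S^1}\langle\vec H,J\nabla h\rangle\,d\mathrm{vol}=0$ for every $h\in C^\infty(\mathbb{C}P^2,\mathbb{R})$, where $\vec H$ is the mean curvature vector and $d\mathrm{vol}$ the area element of the induced metric; - $u$ is homogeneous: there are skew-Hermitian $3\times 3$ matrices $A,B$ with $u(x+t,y)=e^{tA}u(x,y)$ and $u(x,y+t)=e^{tB}u(x,y)$ for all $x,y\in S^1$, $t\in\mathbb{R}$. It is *minimal* if $\vec H=0$, and *special Lagrangian* if its Lagrangian angle $\beta$ is constant, i.e. if for every Legendrian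 (horizontal) local lift $\hat u$ of $u$ to $S^5$ over a connected open subset $W$ of the universal cover $\mathbb{R}^2$ the function $e^{i\beta}=dz^1\wedge dz^2\wedge dz^3\,(\hat u,d\hat u(e_1),d\hat u(e_2))$, where $(e_1,e_2)$ is an oriented orthonormal frame for the induced metric, is constant on $W$. For $r_1,r_2,r_3>0$ with $r_1^2+r_2^2+r_3^2=1$ let $$T_r=r_1S^1\times r_2S^1\times r_3S^1=\{z\in\mathbb{C}^3:\ |z^1|=r_1,\ |z^2|=r_2,\ |z^3|=r_3\}\subset S^5.$$ **Theorem.** 1. For every homogeneous Hamiltonian stationary Lagrangian torus $u$ there are $g\in U(3)$ and $r_1,r_2,r_3>0$ with $r_1^2+r_2^2+r_3^2=1$ such that the image of $u$ is $g\cdot\pi(T_r)$. 2. If $u$ is a homogeneous Hamiltonian stationary Lagrangian torus with image $g\cdot\pi(T_r)$, for some $g\in U(3)$ and such $r$, then $u$ is special Lagrangian if and only if $r_1=r_2=r_3=1/\sqrt3$ (that is, the image is congruent to the Clifford torus $\pi(\{|z^1|=|z^2|=|z^3|=1/\sqrt3\})$), and likewise $u$ is minimal if and only if $r_1=r_2=r_3=1/\sqrt3$.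 3. Conversely, for all $r_1,r_2,r_3>0$ with $r_1^2+r_2^2+r_3^2=1$, $\pi(T_r)$ is the image of an injective homogeneous Hamiltonian stationary Lagrangian torus $u$. -/

import Mathlib

open scoped ContDiff Real Topology LinearAlgebra.Projectivization

namespace HSLTorus

noncomputable section

/-! ### The complex projective plane and the Hopf map -/

/-- `ℂ³` with its standard Hermitian inner product. As in Mathlib, `inner ℂ` is conjugate-linear
in the first variable. -/
abbrev C3 : Type := EuclideanSpace ℂ (Fin 3)

/-- The complex projective plane, as the set of complex lines of `ℂ³`. -/
abbrev CP2 : Type := ℙ ℂ C3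

/-- The unit sphere `S⁵` in `ℂ³`. -/
abbrev S5 : Set C3 := Metric.sphere (0 : C3) 1

/-- The Hopf map `π : S⁵ → ℂP²`, `z ↦ [z]`. -/
def hopf (z : S5) : CP2 := Projectivization.mk ℂ (z : C3) (ne_zero_of_mem_unit_sphere z)

theorem toEuclideanLin_injective {M : Matrix (Fin 3) (Fin 3) ℂ} (hM : IsUnit M) :
    Function.Injective (Matrix.toEuclideanLin M) := by
  intro v w h
  have h2 : M.mulVec v.ofLp = M.mulVec w.ofLp := congrArg WithLp.ofLp h
  exact WithLp.ofLp_injective 2 (Matrix.mulVec_injective_of_isUnit hM h2)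

/-- The projective transformation `[z] ↦ [M z]` of `ℂP²` induced by an invertible matrix `M`. -/
def projAct (M : Matrix (Fin 3) (Fin 3) ℂ) (hM : IsUnit M) : CP2 → CP2 :=
  Projectivization.map (Matrix.toEuclideanLin M) (toEuclideanLin_injective hM)

/-- The action of `U(3)` on `ℂP²`. -/
def unitaryAct (g : Matrix.unitaryGroup (Fin 3) ℂ) : CP2 → CP2 :=
  projAct (g : Matrix (Fin 3) (Fin 3) ℂ) (Unitary.isUnit_coe (U := g))

/-- The action of `e^{tA}` on `ℂP²`. -/
def expAct (A : Matrix (Fin 3) (Fin 3) ℂ) (t : ℝ) : CP2 → CP2 :=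
  projAct (NormedSpace.exp ((t : ℂ) • A)) (Matrix.isUnit_exp _)

/-- The product torus `r₁S¹ × r₂S¹ × r₃S¹ = {z | |z_i| = r_i}`, for `∑ r_i² = 1` a subset of the
unit sphere. -/
def productTorus (r : Fin 3 → ℝ) : Set S5 := {z | ∀ i, ‖(z : C3) i‖ = r i}

/-! ### Smooth maps into `ℂP²`

The differential geometry of `ℂP² = S⁵/S¹` is expressed through lifts to `S⁵`: the tangent space of
`ℂP²` at `[z]`, `z ∈ S⁵`, is the space `H_z` of vectors Hermitian orthogonal to `z`, and the
Fubini-Study metric is the one for which `dπ_z : H_z → T_{[z]} ℂP²` is a complex isometry. None of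
the geometric notions below depends on the choice of the lifts. -/

/-- `f` is a smooth lift to `S⁵`, over the open set `W`, of the map `U : ℝ² → ℂP²`. -/
structure IsLift (U : ℝ × ℝ → CP2) (W : Set (ℝ × ℝ)) (f : ℝ × ℝ → C3) : Prop where
  isOpen : IsOpen W
  smooth : ContDiffOn ℝ ∞ f W
  lifts : ∀ p ∈ W, ∃ h : f p ∈ S5, hopf ⟨f p, h⟩ = U p

/-- A map from the plane to `ℂP²` is smooth if it has smooth lifts to `S⁵` near every point. -/
def SmoothMap (U : ℝ × ℝ → CP2) : Prop :=
  ∀ p, ∃ W f, p ∈ W ∧ IsLift U W f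

/-- A function on `ℂP²` read on `ℂ³ ∖ {0}` (and extended by `0` to the origin). -/
def onC3 (h : CP2 → ℝ) (z : C3) : ℝ :=
  open Classical in if hz : z ≠ 0 then h (Projectivization.mk ℂ z hz) else 0

/-- Smoothness of a real function on `ℂP²`. -/
def SmoothFun (h : CP2 → ℝ) : Prop := ContDiffOn ℝ ∞ (onC3 h) {0}ᶜ

/-- The orthogonal projection of `ℂ³` on the horizontal space `H_z`, for `z ∈ S⁵`. -/
def hor (z v : C3) : C3 := v - (inner ℂ z v : ℂ) • z

/-- The Kähler form `ω(X, Y) = -Im ⟨X, Y⟩`, where `⟨X, Y⟩ = g(X, Y) - i ω(X, Y)` is the Hermitian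
metric that is complex linear in `X`. -/
def kahler (X Y : C3) : ℝ := - (inner ℂ Y X : ℂ).im

/-- The horizontal lift, along the lift `f` of `U`, of `dU_p(v)`. -/
def dHor (f : ℝ × ℝ → C3) (p v : ℝ × ℝ) : C3 := hor (f p) (fderiv ℝ f p v)

/-- The map `U` has an injective differential everywhere. -/
def IsImmersion (U : ℝ × ℝ → CP2) : Prop :=
  SmoothMap U ∧ ∀ W f, IsLift U W f → ∀ p ∈ W, Function.Injective (dHor f p)

/-- The immersion `U` of a surface is Lagrangian: `U^* ω = 0`. -/
def IsLagrangianImmersion (U : ℝ × ℝ → CP2) : Prop :=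
  IsImmersion U ∧ ∀ W f, IsLift U W f → ∀ p ∈ W, ∀ v w, kahler (dHor f p v) (dHor f p w) = 0

/-! ### Induced metric, mean curvature, Hamiltonian stationarity -/

/-- The coordinate vectors of the plane. -/
def coordVec : Fin 2 → ℝ × ℝ := ![(1, 0), (0, 1)]

/-- The matrix `(g_ij)` of the metric induced by the Fubini-Study metric. -/
def gram (f : ℝ × ℝ → C3) (p : ℝ × ℝ) : Matrix (Fin 2) (Fin 2) ℝ :=
  Matrix.of fun i j => inner ℝ (dHor f p (coordVec i)) (dHor f p (coordVec j))

/-- The density of the induced area. -/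
def areaDensity (f : ℝ × ℝ → C3) (p : ℝ × ℝ) : ℝ := √(gram f p).det

/-- The covariant derivative, for the Levi-Civita connection of the Fubini-Study metric, of a
vector field along `U` in the direction `v`: the field is given by its horizontal lift `V` along
`f`, so that the derivative is `V' = dV(v)`, corrected for the vertical part
`⟨f, df(v)⟩ f` of `df(v)` and projected on the horizontal space. -/
def covDeriv (f V : ℝ × ℝ → C3) (p v : ℝ × ℝ) : C3 :=
  hor (f p) (fderiv ℝ V p v - (inner ℂ (f p) (fderiv ℝ f p v) : ℂ) • V p)

/-- The component of a horizontal vector `X` normal to the immersed surface: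
`X - ∑ g^{kl} ⟨X, ∂_k U⟩ ∂_l U`. -/
def normalPart (f : ℝ × ℝ → C3) (p : ℝ × ℝ) (X : C3) : C3 :=
  X - ∑ k, ∑ l, ((gram f p)⁻¹ k l * inner ℝ X (dHor f p (coordVec k))) • dHor f p (coordVec l)

/-- The second fundamental form `II(∂_i, ∂_j)`. -/
def secondFF (f : ℝ × ℝ → C3) (p : ℝ × ℝ) (i j : Fin 2) : C3 :=
  normalPart f p (covDeriv f (fun q => dHor f q (coordVec j)) p (coordVec i))

/-- (The horizontal lift of) the mean curvature vector, half the trace of the second fundamental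
form with respect to the induced metric. -/
def meanCurvature (f : ℝ × ℝ → C3) (p : ℝ × ℝ) : C3 :=
  (1 / 2 : ℝ) • ∑ i, ∑ j, (gram f p)⁻¹ i j • secondFF f p i j

/-- (The horizontal lift at `z ∈ S⁵` of) the Hamiltonian vector field `ξ_h = J ∇h` on `ℂP²`. The
gradient of the homogeneous extension of `h` at `z` is horizontal, as `h` is constant on complex
lines. -/
def hamiltonianField (h : CP2 → ℝ) (z : C3) : C3 := Complex.I • gradient (onC3 h) z

/-- Some lift of `U` defined near `p`. -/
def someLift (U : ℝ × ℝ → CP2) (p : ℝ × ℝ) : ℝ × ℝ → C3 :=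
  Classical.epsilon fun f => ∃ W, p ∈ W ∧ IsLift U W f

/-- The function `⟨H, ξ_h⟩ dvol / (dx dy)` on the plane; it is independent of the lift which is used
to compute it. -/
def variationDensity (U : ℝ × ℝ → CP2) (h : CP2 → ℝ) (p : ℝ × ℝ) : ℝ :=
  inner ℝ (meanCurvature (someLift U p) p) (hamiltonianField h (someLift U p p)) *
    areaDensity (someLift U p) p

/-- The torus `S¹ × S¹`, with `S¹ = ℝ/2πℤ`. -/
abbrev Torus : Type := AddCircle (2 * π) × AddCircle (2 * π)

/-- A map on the torus as a doubly periodic map on the plane. -/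
def onPlane (u : Torus → CP2) (p : ℝ × ℝ) : CP2 :=
  u ((p.1 : AddCircle (2 * π)), (p.2 : AddCircle (2 * π)))

/-- The first variation `∫ ⟨H, ξ_h⟩ dvol` of the area of the immersed torus `u` under every
Hamiltonian vector field `ξ_h` vanishes. -/
def IsHamiltonianStationary (u : Torus → CP2) : Prop :=
  ∀ h : CP2 → ℝ, SmoothFun h →
    ∫ x in (0 : ℝ)..2 * π, ∫ y in (0 : ℝ)..2 * π, variationDensity (onPlane u) h (x, y) = 0

/-- `u(x + t, y) = e^{tA} u(x, y)` and `u(x, y + t) = e^{tB} u(x, y)` for some skew-Hermitian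
matrices `A` and `B`. -/
def IsHomogeneous (u : Torus → CP2) : Prop :=
  ∃ A B : Matrix (Fin 3) (Fin 3) ℂ, A.conjTranspose = -A ∧ B.conjTranspose = -B ∧
    (∀ (x y : AddCircle (2 * π)) (t : ℝ),
      u (x + (t : AddCircle (2 * π)), y) = expAct A t (u (x, y))) ∧
    (∀ (x y : AddCircle (2 * π)) (t : ℝ),
      u (x, y + (t : AddCircle (2 * π))) = expAct B t (u (x, y)))

/-- Homogeneous Hamiltonian stationary Lagrangian (immersed) tori in `ℂP²`. -/
structure IsHomogeneousHSLTorus (u : Torus → CP2) : Prop where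
  lagrangian : IsLagrangianImmersion (onPlane u)
  stationary : IsHamiltonianStationary u
  homogeneous : IsHomogeneous u

/-! ### Minimal and special Lagrangian tori -/

/-- The mean curvature vector vanishes. -/
def IsMinimal (u : Torus → CP2) : Prop :=
  ∀ W f, IsLift (onPlane u) W f → ∀ p ∈ W, meanCurvature f p = 0

/-- The lift `f` is parallel for the Hopf connection, that is, horizontal. -/
def IsLegendrian (W : Set (ℝ × ℝ)) (f : ℝ × ℝ → C3) : Prop :=
  ∀ p ∈ W, ∀ v, (inner ℂ (f p) (fderiv ℝ f p v) : ℂ) = 0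

/-- `e^{iβ}`, where `β` is the Lagrangian angle of the Legendrian lift `f`:
`e^{iβ} = dz¹ ∧ dz² ∧ dz³ (f, df(e₁), df(e₂))` for an oriented orthonormal frame `(e₁, e₂)` of the
plane with the induced metric, so that `e₁ ∧ e₂ = (∂_x ∧ ∂_y) / √det g`. -/
def expLagrangianAngle (f : ℝ × ℝ → C3) (p : ℝ × ℝ) : ℂ :=
  (Matrix.of fun a b : Fin 3 =>
    (![f p, fderiv ℝ f p (coordVec 0), fderiv ℝ f p (coordVec 1)] a : C3) b).det /
      (areaDensity f p : ℂ)

/-- The Lagrangian angle, computed along Legendrian lifts over connected open sets, is constant. -/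
def IsSpecialLagrangian (u : Torus → CP2) : Prop :=
  ∀ W f, IsLift (onPlane u) W f → IsLegendrian W f → IsPreconnected W →
    ∃ c : ℂ, ∀ p ∈ W, expLagrangianAngle f p = c

end

end HSLTorus

/-!
Along a homogeneous Lagrangian torus the velocity fields of the two one-parameter groups are induced
by skew-Hermitian matrices, and the vanishing of `ω` on them at every point makes the matrices
commute. In a joint eigenbasis the torus lifts to the horizontal orbit `p ↦ ∑ z_j e^{i α_j(p)} b_j`,
where `∑ |z_j|² α_j = 0`; since a point of the lift and its two velocities span `ℂ³`, all the `z_j`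
are nonzero, and the image is a product torus of radii `|z_j|`.

All the coordinate fields of such an orbit are diagonal, so the mean curvature vector `H` is a
diagonal field too, and it vanishes exactly when the radii agree. The Lagrangian angle is `∑ α_j` up
to a constant, and the linear form `∑ α_j` vanishes under the same condition. Moreover `i H` is the
velocity of a one-parameter group of translations of the torus, so the first variation of the area
under a Hamiltonian is the integral of a total derivative and stationarity is automatic. Finally,
the image determines whether the radii agree: averaging over the signs of the coordinates expresses
the squared radii in one basis through those in another.
-/

namespace HSLTorus

noncomputable section

/-- The Hermitian product of `ℂ³` coming from its structure of inner product space. Declared here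
so that it takes precedence over the (definitionally equal) one of Hilbert `C⋆`-modules, which is
the one that instance search finds in the definitions above. -/
instance instInnerC3 : Inner ℂ C3 := InnerProductSpace.toInner

theorem hor_eq (z v : C3) : hor z v = v - (inner ℂ z v : ℂ) • z := rfl

theorem kahler_eq (X Y : C3) : kahler X Y = -(inner ℂ Y X : ℂ).im := rfl

theorem covDeriv_eq (f V : ℝ × ℝ → C3) (p v : ℝ × ℝ) :
    covDeriv f V p v =
      hor (f p) (fderiv ℝ V p v - (inner ℂ (f p) (fderiv ℝ f p v) : ℂ) • V p) := rfl

theorem isLegendrian_iff {W : Set (ℝ × ℝ)} {f : ℝ × ℝ → C3} :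
    IsLegendrian W f ↔ ∀ p ∈ W, ∀ v, (inner ℂ (f p) (fderiv ℝ f p v) : ℂ) = 0 := Iff.rfl

/-! ### Unit vectors and complex lines -/

section Lines

variable {E : Type*} [NormedAddCommGroup E] [InnerProductSpace ℂ E]

theorem inner_smul_smul_of_norm_eq_one {c : ℂ} (hc : ‖c‖ = 1) (x y : E) :
    (inner ℂ (c • x) (c • y) : ℂ) = inner ℂ x y := by
  rw [inner_smul_left, inner_smul_right, ← mul_assoc, Complex.conj_mul', hc]
  simp

theorem mem_submodule_iff {P : ℙ ℂ E} {z : E} (hz : z ≠ 0) :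
    z ∈ P.submodule ↔ Projectivization.mk ℂ z hz = P := by
  induction P using Projectivization.ind with
  | h v hv =>
    rw [Projectivization.submodule_mk, Submodule.mem_span_singleton,
      Projectivization.mk_eq_mk_iff']

theorem eq_inner_smul_of_mem_submodule {P : ℙ ℂ E} {z w : E} (hz : ‖z‖ = 1)
    (hzP : z ∈ P.submodule) (hw : w ∈ P.submodule) : w = (inner ℂ z w : ℂ) • z := by
  have hz0 : z ≠ 0 := norm_ne_zero_iff.1 (hz ▸ one_ne_zero)
  obtain rfl := (mem_submodule_iff hz0).1 hzP
  rw [Projectivization.submodule_mk] at hw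
  obtain ⟨a, rfl⟩ := Submodule.mem_span_singleton.1 hw
  rw [inner_smul_right, inner_self_eq_one_of_norm_eq_one hz, mul_one]

theorem linearIndependent_complex_of_im_inner_eq_zero {ι : Type*} {x : ι → E}
    (hx : ∀ i j, (inner ℂ (x i) (x j) : ℂ).im = 0) (h : LinearIndependent ℝ x) :
    LinearIndependent ℂ x := by
  rw [linearIndependent_iff'] at h ⊢
  intro s c hc
  set y := ∑ i ∈ s, (c i).re • x i with hy
  set z := ∑ i ∈ s, (c i).im • x i with hz
  have hyz : y + Complex.I • z = 0 := by
    rw [← hc, hy, hz, Finset.smul_sum, ← Finset.sum_add_distrib]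
    refine Finset.sum_congr rfl fun i _ => ?_
    conv_rhs => rw [← Complex.re_add_im (c i), add_smul, mul_comm, mul_smul]
    simp only [Complex.coe_smul]
  have him : (inner ℂ y z : ℂ).im = 0 := by
    simp [hy, hz, hx]
  have hy0 : y = 0 := by
    have h0 : (inner ℂ y (y + Complex.I • z) : ℂ).re = 0 := by rw [hyz, inner_zero_right]; rfl
    rw [inner_add_right, inner_smul_right, Complex.add_re, Complex.I_mul_re, him, neg_zero,
      add_zero] at h0
    exact inner_self_eq_zero.1 (Complex.ext h0 (inner_self_im (𝕜 := ℂ) y))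
  have hz0 : z = 0 := by simpa [hy0] using hyz
  intro i hi
  exact Complex.ext (h s _ hy0 i hi) (h s _ hz0 i hi)

end Lines

/-! ### Horizontal vectors -/

section Horizontal

variable {z : C3} (v w : C3)

theorem hor_add : hor z (v + w) = hor z v + hor z w := by
  simp only [hor_eq, inner_add_right, add_smul]
  abel

theorem hor_smul (c : ℂ) : hor z (c • v) = c • hor z v := by
  simp only [hor_eq, inner_smul_right, smul_sub, smul_smul]

theorem hor_self (hz : ‖z‖ = 1) : hor z z = 0 := by
  rw [hor_eq, inner_self_eq_one_of_norm_eq_one hz, one_smul, sub_self]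

theorem hor_smul_left {c : ℂ} (hc : ‖c‖ = 1) : hor (c • z) v = hor z v := by
  rw [hor_eq, hor_eq, inner_smul_left, smul_smul, mul_right_comm, Complex.conj_mul', hc]
  simp

theorem inner_hor (hz : ‖z‖ = 1) : (inner ℂ z (hor z v) : ℂ) = 0 := by
  rw [hor_eq, inner_sub_right, inner_smul_right, inner_self_eq_one_of_norm_eq_one hz, mul_one,
    sub_self]

theorem inner_hor_hor (hz : ‖z‖ = 1) :
    (inner ℂ (hor z v) (hor z w) : ℂ) = inner ℂ v w - inner ℂ v z * inner ℂ z w := by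
  conv_lhs => rw [hor_eq z v]
  rw [inner_sub_left, inner_smul_left, inner_hor w hz, mul_zero, sub_zero, hor_eq,
    inner_sub_right, inner_smul_right, mul_comm]

variable (f : ℝ × ℝ → C3) (p : ℝ × ℝ)

theorem isLinearMap_dHor : IsLinearMap ℝ (dHor f p) where
  map_add v w := by rw [dHor, map_add, hor_add]; rfl
  map_smul c v := by rw [dHor, map_smul, ← Complex.coe_smul, hor_smul]; rfl

variable {f p}

theorem linearIndependent_dHor (h : Function.Injective (dHor f p)) :
    LinearIndependent ℝ fun i => dHor f p (coordVec i) := by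
  have hcoord : coordVec = Module.Basis.finTwoProd ℝ := by
    ext i : 1
    fin_cases i <;> simp [coordVec]
  rw [hcoord]
  exact (Module.Basis.finTwoProd ℝ).linearIndependent.map' ((isLinearMap_dHor f p).mk' _)
    (LinearMap.ker_eq_bot.2 h)

theorem gram_posDef (h : Function.Injective (dHor f p)) : (gram f p).PosDef :=
  Matrix.posDef_gram_of_linearIndependent (linearIndependent_dHor h)

theorem areaDensity_pos (h : Function.Injective (dHor f p)) : 0 < areaDensity f p :=
  Real.sqrt_pos.2 (gram_posDef h).det_pos

end Horizontal

/-! ### Change of lift -/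

/-- The transition function between two lifts `f` and `g` of the same map, for which
`f = transition f g • g`. -/
def transition (f g : ℝ × ℝ → C3) (p : ℝ × ℝ) : ℂ := inner ℂ (g p) (f p)

namespace IsLift

variable {U : ℝ × ℝ → CP2} {W W' : Set (ℝ × ℝ)} {f g : ℝ × ℝ → C3} {p : ℝ × ℝ}

theorem norm_eq_one (hf : IsLift U W f) (hp : p ∈ W) : ‖f p‖ = 1 := by
  simpa using (hf.lifts p hp).1

theorem mem_submodule (hf : IsLift U W f) (hp : p ∈ W) : f p ∈ (U p).submodule := by
  obtain ⟨h, hU⟩ := hf.lifts p hp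
  exact (mem_submodule_iff (ne_zero_of_mem_unit_sphere ⟨f p, h⟩)).2 hU

theorem of_mem_submodule (hW : IsOpen W) (hf : ContDiffOn ℝ ∞ f W) (hnorm : ∀ p ∈ W, ‖f p‖ = 1)
    (hmem : ∀ p ∈ W, f p ∈ (U p).submodule) : IsLift U W f where
  isOpen := hW
  smooth := hf
  lifts p hp := ⟨by simpa using hnorm p hp, (mem_submodule_iff _).1 (hmem p hp)⟩

theorem contDiffAt (hf : IsLift U W f) (hp : p ∈ W) : ContDiffAt ℝ ∞ f p :=
  hf.smooth.contDiffAt (hf.isOpen.mem_nhds hp)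

theorem differentiableAt (hf : IsLift U W f) (hp : p ∈ W) : DifferentiableAt ℝ f p :=
  (hf.contDiffAt hp).differentiableAt (by simp)

theorem differentiableAt_dHor (hf : IsLift U W f) (hp : p ∈ W) (v : ℝ × ℝ) :
    DifferentiableAt ℝ (fun q => dHor f q v) p := by
  have hdf : DifferentiableAt ℝ (fun q => fderiv ℝ f q v) p :=
    (((hf.contDiffAt hp).fderiv_right (m := ∞) (by simp)).clm_apply
      contDiffAt_const).differentiableAt (by simp)
  exact hdf.sub (((hf.differentiableAt hp).inner ℂ hdf).smul (hf.differentiableAt hp))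

theorem eventually_mem_inter (hf : IsLift U W f) (hg : IsLift U W' g) (hp : p ∈ W)
    (hp' : p ∈ W') : ∀ᶠ q in 𝓝 p, q ∈ W ∧ q ∈ W' :=
  (hf.isOpen.inter hg.isOpen).mem_nhds ⟨hp, hp'⟩

section Transition

variable (hf : IsLift U W f) (hg : IsLift U W' g) (hp : p ∈ W) (hp' : p ∈ W')
include hf hg hp hp'

theorem eq_transition_smul : f p = transition f g p • g p :=
  eq_inner_smul_of_mem_submodule (hg.norm_eq_one hp') (hg.mem_submodule hp') (hf.mem_submodule hp)

theorem norm_transition : ‖transition f g p‖ = 1 := by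
  have h := congrArg norm (hf.eq_transition_smul hg hp hp')
  rw [norm_smul, hf.norm_eq_one hp, hg.norm_eq_one hp', mul_one] at h
  exact h.symm

theorem differentiableAt_transition : DifferentiableAt ℝ (transition f g) p :=
  (hg.differentiableAt hp').inner ℂ (hf.differentiableAt hp)

theorem fderiv_eq (v : ℝ × ℝ) :
    fderiv ℝ f p v = transition f g p • fderiv ℝ g p v + fderiv ℝ (transition f g) p v • g p := by
  have heq : f =ᶠ[𝓝 p] fun q => transition f g q • g q := by
    filter_upwards [hf.eventually_mem_inter hg hp hp'] with q hq
    exact hf.eq_transition_smul hg hq.1 hq.2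
  rw [heq.fderiv_eq, fderiv_fun_smul (hf.differentiableAt_transition hg hp hp')
    (hg.differentiableAt hp')]
  rfl

theorem dHor_eq (v : ℝ × ℝ) : dHor f p v = transition f g p • dHor g p v := by
  rw [dHor, dHor, hf.fderiv_eq hg hp hp', hf.eq_transition_smul hg hp hp',
    hor_smul_left _ (hf.norm_transition hg hp hp'), hor_add, hor_smul, hor_smul,
    hor_self (hg.norm_eq_one hp'), smul_zero, add_zero]

theorem real_inner_transition_smul (x y : C3) :
    inner ℝ (transition f g p • x) (transition f g p • y) = inner ℝ x y :=
  congrArg Complex.re (inner_smul_smul_of_norm_eq_one (hf.norm_transition hg hp hp') x y)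

theorem gram_eq : gram f p = gram g p := by
  ext i j
  simp only [gram, Matrix.of_apply, hf.dHor_eq hg hp hp']
  exact hf.real_inner_transition_smul hg hp hp' _ _

theorem areaDensity_eq : areaDensity f p = areaDensity g p := by
  rw [areaDensity, areaDensity, hf.gram_eq hg hp hp']

theorem covDeriv_dHor_eq (v w : ℝ × ℝ) :
    covDeriv f (fun q => dHor f q w) p v =
      transition f g p • covDeriv g (fun q => dHor g q w) p v := by
  have heq : (fun q => dHor f q w) =ᶠ[𝓝 p] fun q => transition f g q • dHor g q w := by
    filter_upwards [hf.eventually_mem_inter hg hp hp'] with q hq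
    exact hf.dHor_eq hg hq.1 hq.2 w
  have hc := hf.norm_transition hg hp hp'
  have hvert : (inner ℂ (f p) (fderiv ℝ f p v) : ℂ) * transition f g p =
      transition f g p * inner ℂ (g p) (fderiv ℝ g p v) + fderiv ℝ (transition f g) p v := by
    have hcc : (starRingEnd ℂ) (transition f g p) * transition f g p = 1 := by
      rw [Complex.conj_mul', hc]; simp
    rw [hf.fderiv_eq hg hp hp', hf.eq_transition_smul hg hp hp', inner_add_right,
      inner_smul_smul_of_norm_eq_one hc, inner_smul_left, inner_smul_right,
      inner_self_eq_one_of_norm_eq_one (hg.norm_eq_one hp')]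
    linear_combination (fderiv ℝ (transition f g) p v) * hcc
  rw [covDeriv_eq, covDeriv_eq, heq.fderiv_eq,
    fderiv_fun_smul (hf.differentiableAt_transition hg hp hp') (hg.differentiableAt_dHor hp' w),
    hf.dHor_eq hg hp hp', smul_smul, hvert, hf.eq_transition_smul hg hp hp', hor_smul_left _ hc,
    ← hor_smul]
  congr 1
  simp only [add_apply, smul_apply, ContinuousLinearMap.smulRight_apply]
  module

theorem normalPart_eq (X : C3) :
    normalPart f p (transition f g p • X) = transition f g p • normalPart g p X := by
  simp only [normalPart, hf.gram_eq hg hp hp', hf.dHor_eq hg hp hp',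
    hf.real_inner_transition_smul hg hp hp', smul_sub, Finset.smul_sum,
    smul_comm (transition f g p)]

theorem secondFF_eq (i j : Fin 2) : secondFF f p i j = transition f g p • secondFF g p i j := by
  rw [secondFF, secondFF, hf.covDeriv_dHor_eq hg hp hp', hf.normalPart_eq hg hp hp']

theorem meanCurvature_eq : meanCurvature f p = transition f g p • meanCurvature g p := by
  simp only [meanCurvature, hf.gram_eq hg hp hp', hf.secondFF_eq hg hp hp', Finset.smul_sum,
    smul_comm (transition f g p)]

end Transition

theorem fderiv_transition_eq_zero (hf : IsLift U W f) (hg : IsLift U W' g) (hp : p ∈ W)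
    (hp' : p ∈ W') (hf' : IsLegendrian W f) (hg' : IsLegendrian W' g) :
    fderiv ℝ (transition f g) p = 0 := by
  refine ContinuousLinearMap.ext fun v => ?_
  have h := isLegendrian_iff.1 hf' p hp v
  rw [hf.fderiv_eq hg hp hp', hf.eq_transition_smul hg hp hp', inner_add_right,
    inner_smul_smul_of_norm_eq_one (hf.norm_transition hg hp hp'),
    isLegendrian_iff.1 hg' p hp' v, zero_add, inner_smul_right, inner_smul_left,
    inner_self_eq_one_of_norm_eq_one (hg.norm_eq_one hp'), mul_one] at h
  refine (mul_eq_zero.1 h).resolve_right fun h0 => ?_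
  exact norm_ne_zero_iff.1 (hf.norm_transition hg hp hp' ▸ one_ne_zero) ((map_eq_zero _).1 h0)

theorem expLagrangianAngle_eq (hf : IsLift U W f) (hg : IsLift U W' g) (hp : p ∈ W)
    (hp' : p ∈ W') (hf' : IsLegendrian W f) (hg' : IsLegendrian W' g) :
    expLagrangianAngle f p = transition f g p ^ 3 * expLagrangianAngle g p := by
  have hframe : (Matrix.of fun a b : Fin 3 =>
      (![f p, fderiv ℝ f p (coordVec 0), fderiv ℝ f p (coordVec 1)] a : C3) b) =
      transition f g p • Matrix.of fun a b : Fin 3 =>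
        (![g p, fderiv ℝ g p (coordVec 0), fderiv ℝ g p (coordVec 1)] a : C3) b := by
    ext a b
    fin_cases a <;>
      simp [hf.fderiv_eq hg hp hp', hf.fderiv_transition_eq_zero hg hp hp' hf' hg',
        hf.eq_transition_smul hg hp hp']
  rw [expLagrangianAngle, expLagrangianAngle, hframe, Matrix.det_smul,
    hf.areaDensity_eq hg hp hp', Fintype.card_fin, mul_div_assoc]

end IsLift

/-! ### Lagrangian frames -/

namespace IsLagrangianImmersion

variable {U : ℝ × ℝ → CP2} {W : Set (ℝ × ℝ)} {f : ℝ × ℝ → C3} {p : ℝ × ℝ}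

theorem im_inner_dHor_dHor (hU : IsLagrangianImmersion U) (hf : IsLift U W f) (hp : p ∈ W)
    (v w : ℝ × ℝ) : (inner ℂ (dHor f p v) (dHor f p w) : ℂ).im = 0 :=
  neg_eq_zero.1 (hU.2 W f hf p hp w v)

theorem linearIndependent_frame (hU : IsLagrangianImmersion U) (hf : IsLift U W f)
    (hp : p ∈ W) :
    LinearIndependent ℂ ![f p, dHor f p (coordVec 0), dHor f p (coordVec 1)] := by
  have htangent : LinearIndependent ℂ fun i => dHor f p (coordVec i) :=
    linearIndependent_complex_of_im_inner_eq_zero (fun _ _ => hU.im_inner_dHor_dHor hf hp _ _)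
      (linearIndependent_dHor (hU.1.2 W f hf p hp))
  have hnotMem : f p ∉ Submodule.span ℂ (Set.range fun i => dHor f p (coordVec i)) := by
    intro h
    have hle : Submodule.span ℂ (Set.range fun i => dHor f p (coordVec i)) ≤ (ℂ ∙ f p)ᗮ := by
      rw [Submodule.span_le, Set.range_subset_iff]
      exact fun i => Submodule.mem_orthogonal_singleton_iff_inner_right.2
        (inner_hor _ (hf.norm_eq_one hp))
    have h0 := Submodule.mem_orthogonal_singleton_iff_inner_right.1 (hle h)
    have h1 := inner_self_eq_one_of_norm_eq_one (𝕜 := ℂ) (hf.norm_eq_one hp)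
    exact zero_ne_one (h0.symm.trans h1)
  have hcons : ![f p, dHor f p (coordVec 0), dHor f p (coordVec 1)] =
      Fin.cons (f p) fun i => dHor f p (coordVec i) := by
    ext i : 1
    fin_cases i <;> rfl
  rw [hcons]
  exact linearIndependent_finCons.2 ⟨htangent, hnotMem⟩

theorem expLagrangianAngle_ne_zero (hU : IsLagrangianImmersion U) (hf : IsLift U W f)
    (hleg : IsLegendrian W f) (hp : p ∈ W) : expLagrangianAngle f p ≠ 0 := by
  have hdHor : ∀ v, dHor f p v = fderiv ℝ f p v := fun v => by
    rw [dHor, hor_eq, isLegendrian_iff.1 hleg p hp, zero_smul, sub_zero]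
  have hframe := (hU.linearIndependent_frame hf hp).map'
    (WithLp.linearEquiv 2 ℂ (Fin 3 → ℂ) : C3 →ₗ[ℂ] Fin 3 → ℂ) (LinearEquiv.ker _)
  have hdet := (Matrix.isUnit_iff_isUnit_det _).1
    (Matrix.linearIndependent_rows_iff_isUnit.1 hframe)
  simp only [hdHor] at hdet
  exact div_ne_zero hdet.ne_zero
    (Complex.ofReal_ne_zero.2 (areaDensity_pos (hU.1.2 W f hf p hp)).ne')

end IsLagrangianImmersion

/-! ### Orbits of diagonal unitary groups -/

section ToricField

variable {ι E V : Type*} [Fintype ι] [NormedAddCommGroup E] [InnerProductSpace ℂ E]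
  [NormedAddCommGroup V] [NormedSpace ℝ V]

/-- The vector field `∑ θ_j z_j e^{i α_j} b_j` along the orbit `toricLift b z α`. -/
def toricField (b : OrthonormalBasis ι ℂ E) (z : ι → ℂ) (α : ι → V →L[ℝ] ℝ) (θ : ι → ℂ)
    (p : V) : E :=
  ∑ j, (θ j * (z j * Complex.exp (α j p * Complex.I))) • b j

/-- The orbit `p ↦ ∑ z_j e^{i α_j(p)} b_j` of the point `∑ z_j b_j` under a group of unitary maps
which are diagonal in the basis `b`. -/
def toricLift (b : OrthonormalBasis ι ℂ E) (z : ι → ℂ) (α : ι → V →L[ℝ] ℝ) : V → E :=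
  toricField b z α 1

variable (b : OrthonormalBasis ι ℂ E) (z : ι → ℂ) (α : ι → V →L[ℝ] ℝ) (p : V)

theorem toricLift_apply :
    toricLift b z α p = ∑ j, (z j * Complex.exp (α j p * Complex.I)) • b j := by
  simp only [toricLift, toricField, Pi.one_apply, one_mul]

theorem toricField_add (θ η : ι → ℂ) :
    toricField b z α (θ + η) p = toricField b z α θ p + toricField b z α η p := by
  simp only [toricField, Pi.add_apply, add_mul, add_smul, Finset.sum_add_distrib]

theorem toricField_smul (c : ℂ) (θ : ι → ℂ) :
    toricField b z α (c • θ) p = c • toricField b z α θ p := by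
  simp only [toricField, Pi.smul_apply, smul_eq_mul, Finset.smul_sum, smul_smul, mul_assoc]

theorem toricField_sum {κ : Type*} (s : Finset κ) (θ : κ → ι → ℂ) :
    toricField b z α (∑ i ∈ s, θ i) p = ∑ i ∈ s, toricField b z α (θ i) p := by
  simp only [toricField, Finset.sum_apply, Finset.sum_mul, Finset.sum_smul]
  exact Finset.sum_comm

theorem inner_toricField (θ η : ι → ℂ) :
    (inner ℂ (toricField b z α θ p) (toricField b z α η p) : ℂ) =
      ∑ j, (‖z j‖ ^ 2 : ℝ) * ((starRingEnd ℂ) (θ j) * η j) := by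
  rw [toricField, toricField, b.orthonormal.inner_sum]
  refine Finset.sum_congr rfl fun j _ => ?_
  have hz := Complex.conj_mul' (z j)
  have hphase := Complex.conj_mul' (Complex.exp (α j p * Complex.I))
  rw [Complex.norm_exp_ofReal_mul_I, Complex.ofReal_one, one_pow] at hphase
  rw [Complex.ofReal_pow, ← hz, map_mul, map_mul]
  linear_combination
    (starRingEnd ℂ) (θ j) * η j * ((starRingEnd ℂ) (z j) * z j) * hphase

variable {z} in
theorem norm_toricLift (hz : ∑ j, ‖z j‖ ^ 2 = 1) : ‖toricLift b z α p‖ = 1 := by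
  have hinner : (inner ℂ (toricLift b z α p) (toricLift b z α p) : ℂ) = 1 := by
    simp only [toricLift, inner_toricField, Pi.one_apply, map_one, mul_one]
    rw [← Complex.ofReal_sum, hz, Complex.ofReal_one]
  have hsq : ‖toricLift b z α p‖ ^ 2 = 1 := by
    rw [← inner_self_eq_norm_sq (𝕜 := ℂ), hinner, RCLike.one_re]
  exact (pow_eq_one_iff_of_nonneg (norm_nonneg _) two_ne_zero).1 hsq

theorem contDiff_toricField (θ : ι → ℂ) : ContDiff ℝ ∞ (toricField b z α θ) := by
  unfold toricField
  have hα := fun j => Complex.ofRealCLM.contDiff.comp (α j).contDiff (n := ∞)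
  exact ContDiff.sum fun j _ => ContDiff.fun_smul (contDiff_const.mul (contDiff_const.mul
    ((hα j).mul contDiff_const).cexp)) contDiff_const

theorem hasFDerivAt_exp_mul_I (β : V →L[ℝ] ℝ) (p : V) :
    HasFDerivAt (fun q => Complex.exp (β q * Complex.I))
      ((Complex.exp (β p * Complex.I) * Complex.I) • Complex.ofRealCLM.comp β) p := by
  have h := ((Complex.ofRealCLM.comp β).hasFDerivAt (x := p)).mul_const Complex.I
  simpa [smul_smul] using h.cexp

theorem fderiv_toricField (θ : ι → ℂ) (v : V) :
    fderiv ℝ (toricField b z α θ) p v =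
      toricField b z α (fun j => θ j * (α j v * Complex.I)) p := by
  have h : HasFDerivAt (toricField b z α θ) _ p :=
    HasFDerivAt.fun_sum fun j (_ : j ∈ Finset.univ) =>
      (((hasFDerivAt_exp_mul_I (α j) p).const_mul (z j)).const_mul (θ j)).smul_const (b j)
  rw [h.fderiv, sum_apply]
  refine Finset.sum_congr rfl fun j _ => ?_
  simp only [ContinuousLinearMap.smulRight_apply, smul_apply, ContinuousLinearMap.comp_apply,
    Complex.ofRealCLM_apply, smul_eq_mul]
  congr 1
  ring

theorem fderiv_toricLift (v : V) :
    fderiv ℝ (toricLift b z α) p v = toricField b z α (fun j => α j v * Complex.I) p := by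
  simp only [toricLift, fderiv_toricField, Pi.one_apply, one_mul]

end ToricField

/-! ### Toric data -/

/-- The orbit `toricLift b z α` is a horizontal immersed submanifold of the unit sphere which is
not contained in a coordinate hyperplane of `b`. -/
structure IsToricDatum {ι V : Type*} [Fintype ι] [NormedAddCommGroup V] [NormedSpace ℝ V]
    (z : ι → ℂ) (α : ι → V →L[ℝ] ℝ) : Prop where
  ne_zero : ∀ j, z j ≠ 0
  sum_sq : ∑ j, ‖z j‖ ^ 2 = 1
  balanced : ∀ v, ∑ j, ‖z j‖ ^ 2 * α j v = 0
  injective : ∀ v, (∀ j, α j v = 0) → v = 0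

/-- The range of `α` lies in the hyperplane `∑ m_j θ_j = 0` and has the same dimension. -/
theorem exists_forall_apply_eq_of_sum_mul_eq_zero {ι K V : Type*} [Fintype ι] [Field K]
    [AddCommGroup V] [Module K V] [FiniteDimensional K V] {m : ι → K} {α : ι → V →ₗ[K] K}
    (hm : m ≠ 0) (hcard : Module.finrank K V + 1 = Fintype.card ι)
    (hinj : ∀ v, (∀ j, α j v = 0) → v = 0) (hbal : ∀ v, ∑ j, m j * α j v = 0)
    {θ : ι → K} (hθ : ∑ j, m j * θ j = 0) : ∃ v, ∀ j, α j v = θ j := by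
  classical
  let ℓ : Module.Dual K (ι → K) := ∑ j, m j • LinearMap.proj j
  have hℓ : ∀ η, ℓ η = ∑ j, m j * η j := fun η => by simp [ℓ]
  have hℓ0 : ℓ ≠ 0 := fun h0 => hm <| funext fun j => by
    simpa [hℓ, Pi.single_apply] using LinearMap.congr_fun h0 (Pi.single j 1)
  have hle : (LinearMap.pi α).range ≤ ℓ.ker := by
    rintro _ ⟨v, rfl⟩
    exact (hℓ _).trans (hbal v)
  have hker : (LinearMap.pi α).ker = ⊥ :=
    LinearMap.ker_eq_bot'.2 fun v hv => hinj v fun j => congrFun hv j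
  have hrange : (LinearMap.pi α).range = ℓ.ker := by
    refine Submodule.eq_of_le_of_finrank_eq hle ?_
    have hfin := Module.Dual.finrank_ker_add_one_of_ne_zero hℓ0
    rw [Module.finrank_fintype_fun_eq_card] at hfin
    rw [LinearMap.finrank_range_of_inj (LinearMap.ker_eq_bot.1 hker)]
    omega
  obtain ⟨v, hv⟩ : θ ∈ (LinearMap.pi α).range := hrange ▸ (hℓ θ).trans hθ
  exact ⟨v, fun j => congrFun hv j⟩

namespace IsToricDatum

section

variable {ι E V : Type*} [Fintype ι] [NormedAddCommGroup E] [InnerProductSpace ℂ E]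
  [NormedAddCommGroup V] [NormedSpace ℝ V] {z : ι → ℂ} {α : ι → V →L[ℝ] ℝ}
  (h : IsToricDatum z α) (b : OrthonormalBasis ι ℂ E) (p : V)
include h

theorem sq_norm_ne_zero (j : ι) : ‖z j‖ ^ 2 ≠ 0 := pow_ne_zero 2 (norm_ne_zero_iff.2 (h.ne_zero j))

theorem inner_toricLift_fderiv (v : V) :
    (inner ℂ (toricLift b z α p) (fderiv ℝ (toricLift b z α) p v) : ℂ) = 0 := by
  have hbal := congrArg ((↑) : ℝ → ℂ) (h.balanced v)
  rw [fderiv_toricLift, toricLift, inner_toricField]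
  simp only [Pi.one_apply, map_one, one_mul, ← mul_assoc, ← Finset.sum_mul]
  push_cast at hbal ⊢
  rw [hbal, zero_mul]

theorem toricField_eq_zero_iff {θ : ι → ℂ} : toricField b z α θ p = 0 ↔ θ = 0 := by
  refine ⟨fun h0 => funext fun k => ?_, fun h0 => by simp [toricField, h0]⟩
  have hk := Fintype.linearIndependent_iff.1 b.orthonormal.linearIndependent _ h0 k
  simpa [h.ne_zero k] using hk

theorem exists_velocity [FiniteDimensional ℝ V] (hcard : Module.finrank ℝ V + 1 = Fintype.card ι)
    {θ : ι → ℝ} (hθ : ∑ j, ‖z j‖ ^ 2 * θ j = 0) : ∃ v, ∀ j, α j v = θ j := by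
  refine exists_forall_apply_eq_of_sum_mul_eq_zero (α := fun j => (α j : V →ₗ[ℝ] ℝ)) ?_ hcard
    h.injective h.balanced hθ
  intro h0
  have hsum := h.sum_sq
  simp [show ∀ j, ‖z j‖ ^ 2 = 0 from congrFun h0] at hsum

/-- The velocity `v` is dual to `α k` for the metric induced by `toricLift`. -/
theorem exists_dual_velocity [DecidableEq ι] [FiniteDimensional ℝ V]
    (hcard : Module.finrank ℝ V + 1 = Fintype.card ι) (k : ι) :
    ∃ v, ∀ j, α j v = (Pi.single k (‖z k‖ ^ 2)⁻¹ : ι → ℝ) j - 1 := by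
  refine h.exists_velocity hcard ?_
  simp only [mul_sub, mul_one, Finset.sum_sub_distrib, h.sum_sq, Pi.single_apply, mul_ite,
    mul_zero, Finset.sum_ite_eq', Finset.mem_univ, if_true, mul_inv_cancel₀ (h.sq_norm_ne_zero k),
    sub_self]

end

end IsToricDatum

theorem map_eq_sum_coordVec {M : Type*} [AddCommGroup M] [Module ℝ M] {L : ℝ × ℝ → M}
    (hL : IsLinearMap ℝ L) (v : ℝ × ℝ) : L v = ∑ i, ![v.1, v.2] i • L (coordVec i) := by
  have hv : v = v.1 • coordVec 0 + v.2 • coordVec 1 := by ext <;> simp [coordVec]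
  calc L v = L (v.1 • coordVec 0 + v.2 • coordVec 1) := congrArg L hv
    _ = ∑ i, ![v.1, v.2] i • L (coordVec i) := by
      rw [hL.map_add, hL.map_smul, hL.map_smul, Fin.sum_univ_two]
      rfl

theorem gram_mulVec (f : ℝ × ℝ → C3) (p v : ℝ × ℝ) :
    (gram f p).mulVec ![v.1, v.2] =
      fun i => inner ℝ (dHor f p (coordVec i)) (dHor f p v) := by
  ext i
  rw [map_eq_sum_coordVec (isLinearMap_dHor f p) v, inner_sum, Matrix.mulVec, dotProduct]
  refine Finset.sum_congr rfl fun k _ => ?_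
  rw [real_inner_smul_right, gram, Matrix.of_apply, mul_comm]

namespace IsToricDatum

variable {z : Fin 3 → ℂ} {α : Fin 3 → ℝ × ℝ →L[ℝ] ℝ} (h : IsToricDatum z α)
  (b : OrthonormalBasis (Fin 3) ℂ C3) (p : ℝ × ℝ)
include h

theorem isLegendrian_toricLift (W : Set (ℝ × ℝ)) : IsLegendrian W (toricLift b z α) :=
  isLegendrian_iff.2 fun p _ v => h.inner_toricLift_fderiv b p v

theorem dHor_toricLift (v : ℝ × ℝ) :
    dHor (toricLift b z α) p v = toricField b z α (fun j => α j v * Complex.I) p := by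
  rw [dHor, hor_eq, h.inner_toricLift_fderiv, zero_smul, sub_zero, fderiv_toricLift]

theorem inner_dHor_toricLift (v w : ℝ × ℝ) :
    (inner ℂ (dHor (toricLift b z α) p v) (dHor (toricLift b z α) p w) : ℂ) =
      (∑ j, ‖z j‖ ^ 2 * (α j v * α j w) : ℝ) := by
  rw [h.dHor_toricLift, h.dHor_toricLift, inner_toricField]
  push_cast
  refine Finset.sum_congr rfl fun j _ => ?_
  simp only [map_mul, Complex.conj_ofReal, Complex.conj_I]
  linear_combination (-(‖z j‖ : ℂ) ^ 2 * α j v * α j w) * Complex.I_mul_I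

theorem injective_dHor_toricLift : Function.Injective (dHor (toricLift b z α) p) := by
  refine ((isLinearMap_dHor _ p).mk' _).ker_eq_bot.1 (LinearMap.ker_eq_bot'.2 fun v hv => ?_)
  have hθ := (h.toricField_eq_zero_iff b p).1 ((h.dHor_toricLift b p v).symm.trans hv)
  exact h.injective v fun j => by simpa using congrFun hθ j

theorem gram_toricLift (i k : Fin 2) :
    gram (toricLift b z α) p i k = ∑ j, ‖z j‖ ^ 2 * (α j (coordVec i) * α j (coordVec k)) :=
  congrArg Complex.re (h.inner_dHor_toricLift b p _ _)

theorem areaDensity_toricLift (q : ℝ × ℝ) :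
    areaDensity (toricLift b z α) p = areaDensity (toricLift b z α) q := by
  have hgram : gram (toricLift b z α) p = gram (toricLift b z α) q := by
    ext i k
    rw [h.gram_toricLift, h.gram_toricLift]
  rw [areaDensity, areaDensity, hgram]

theorem covDeriv_dHor_toricLift (v w : ℝ × ℝ) :
    covDeriv (toricLift b z α) (fun q => dHor (toricLift b z α) q w) p v =
      toricField b z α
        (fun k => ((∑ j, ‖z j‖ ^ 2 * (α j v * α j w) - α k v * α k w : ℝ) : ℂ)) p := by
  have hdHor : (fun q => dHor (toricLift b z α) q w) =
      toricField b z α (fun j => α j w * Complex.I) := funext fun q => h.dHor_toricLift b q w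
  have hfderiv : fderiv ℝ (toricField b z α fun j => α j w * Complex.I) p v =
      toricField b z α (fun j => ((-(α j v * α j w) : ℝ) : ℂ)) p := by
    rw [fderiv_toricField]
    congr 1 with j
    push_cast
    linear_combination (α j v : ℂ) * α j w * Complex.I_mul_I
  have hcomponent : (inner ℂ (toricLift b z α p)
      (toricField b z α (fun j => ((-(α j v * α j w) : ℝ) : ℂ)) p) : ℂ) =
      -((∑ j, ‖z j‖ ^ 2 * (α j v * α j w) : ℝ) : ℂ) := by
    rw [toricLift, inner_toricField]
    simp
  rw [hdHor, covDeriv_eq, h.inner_toricLift_fderiv, zero_smul, sub_zero, hfderiv, hor_eq,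
    hcomponent, neg_smul, sub_neg_eq_add, toricLift, ← toricField_smul, ← toricField_add]
  congr 1 with k
  simp [sub_eq_neg_add]

theorem secondFF_toricLift (i j : Fin 2) :
    secondFF (toricLift b z α) p i j = toricField b z α (fun k =>
      ((gram (toricLift b z α) p i j - α k (coordVec i) * α k (coordVec j) : ℝ) : ℂ)) p := by
  have hnormal : ∀ (θ : Fin 3 → ℝ) (k : Fin 2),
      inner ℝ (toricField b z α (fun j => (θ j : ℂ)) p) (dHor (toricLift b z α) p (coordVec k)) =
        0 := by
    intro θ k
    have hinner := inner_toricField b z α p (fun j => (θ j : ℂ))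
      fun j => α j (coordVec k) * Complex.I
    rw [← h.dHor_toricLift] at hinner
    refine (congrArg Complex.re hinner).trans ?_
    rw [Complex.re_sum]
    refine Finset.sum_eq_zero fun j _ => ?_
    rw [Complex.re_ofReal_mul, Complex.conj_ofReal, Complex.re_ofReal_mul, Complex.re_ofReal_mul,
      Complex.I_re, mul_zero, mul_zero, mul_zero]
  rw [secondFF, h.covDeriv_dHor_toricLift, ← h.gram_toricLift b p, normalPart]
  simp only [hnormal, mul_zero, zero_smul, Finset.sum_const_zero, sub_zero]

theorem sum_gram_inv_mul (k : Fin 3) :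
    ∑ i, ∑ j, (gram (toricLift b z α) p)⁻¹ i j * (α k (coordVec i) * α k (coordVec j)) =
      (‖z k‖ ^ 2)⁻¹ - 1 := by
  obtain ⟨v, hv⟩ := h.exists_dual_velocity (by simp) k
  have hGv : (gram (toricLift b z α) p).mulVec ![v.1, v.2] = fun i => α k (coordVec i) := by
    rw [gram_mulVec]
    ext i
    refine (congrArg Complex.re (h.inner_dHor_toricLift b p _ _)).trans ?_
    simp only [Complex.ofReal_re, hv, Pi.single_apply, mul_sub, mul_one, mul_ite, mul_zero,
      Finset.sum_sub_distrib, Finset.sum_ite_eq', Finset.mem_univ, if_true, h.balanced, sub_zero]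
    rw [mul_left_comm, mul_inv_cancel₀ (h.sq_norm_ne_zero k), mul_one]
  have hdet : IsUnit (gram (toricLift b z α) p).det :=
    (gram_posDef (h.injective_dHor_toricLift b p)).det_pos.ne'.isUnit
  have hinv : (gram (toricLift b z α) p)⁻¹.mulVec (fun i => α k (coordVec i)) = ![v.1, v.2] := by
    rw [← hGv, Matrix.mulVec_mulVec, Matrix.nonsing_inv_mul _ hdet, Matrix.one_mulVec]
  have hk : α k v = (‖z k‖ ^ 2)⁻¹ - 1 := by rw [hv, Pi.single_eq_same]
  have hsum : α k v = ∑ i, ![v.1, v.2] i • α k (coordVec i) :=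
    map_eq_sum_coordVec (α k : ℝ × ℝ →ₗ[ℝ] ℝ).isLinear v
  rw [← hk, hsum, ← hinv]
  refine Finset.sum_congr rfl fun i _ => ?_
  rw [Matrix.mulVec, dotProduct, Finset.sum_smul]
  refine Finset.sum_congr rfl fun j _ => ?_
  rw [smul_eq_mul]
  ring

theorem meanCurvature_toricLift :
    meanCurvature (toricLift b z α) p =
      toricField b z α (fun k => (((3 - (‖z k‖ ^ 2)⁻¹) / 2 : ℝ) : ℂ)) p := by
  have htrace : ∑ i, ∑ j, (gram (toricLift b z α) p)⁻¹ i j * gram (toricLift b z α) p i j = 2 := by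
    have hpos := gram_posDef (h.injective_dHor_toricLift b p)
    calc ∑ i, ∑ j, (gram (toricLift b z α) p)⁻¹ i j * gram (toricLift b z α) p i j
        = ((gram (toricLift b z α) p)⁻¹ * gram (toricLift b z α) p).trace := by
          simp only [Matrix.trace, Matrix.diag_apply, Matrix.mul_apply]
          refine Finset.sum_congr rfl fun i _ => Finset.sum_congr rfl fun j _ => ?_
          rw [← hpos.isHermitian.apply j i, star_trivial]
      _ = 2 := by rw [Matrix.nonsing_inv_mul _ hpos.det_pos.ne'.isUnit]; simp
  simp only [meanCurvature, h.secondFF_toricLift, ← Complex.coe_smul, ← toricField_smul,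
    ← toricField_sum]
  congr 1 with k
  have hk := h.sum_gram_inv_mul b p k
  have hreal : (1 / 2 : ℝ) * ∑ i, ∑ j, (gram (toricLift b z α) p)⁻¹ i j *
      (gram (toricLift b z α) p i j - α k (coordVec i) * α k (coordVec j)) =
        (3 - (‖z k‖ ^ 2)⁻¹) / 2 := by
    simp only [mul_sub, Finset.sum_sub_distrib, htrace, hk]
    ring
  rw [← hreal]
  push_cast
  simp only [Pi.smul_apply, Finset.sum_apply, smul_eq_mul]

end IsToricDatum

/-! ### Minimal and special Lagrangian toric orbits -/

theorem inv_sq_eq_iff {x a : ℝ} (hx : 0 ≤ x) (ha : 0 ≤ a) : (x ^ 2)⁻¹ = a ↔ x = 1 / √a := by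
  constructor
  · rintro rfl
    rw [Real.sqrt_inv, Real.sqrt_sq hx, one_div, inv_inv]
  · rintro rfl
    rw [div_pow, one_pow, one_div, inv_inv, Real.sq_sqrt ha]

theorem toricFrame_eq (b : OrthonormalBasis (Fin 3) ℂ C3) (z : Fin 3 → ℂ)
    (α : Fin 3 → ℝ × ℝ →L[ℝ] ℝ) (p : ℝ × ℝ) :
    (Matrix.of fun a k : Fin 3 =>
      (![toricLift b z α p, fderiv ℝ (toricLift b z α) p (coordVec 0),
        fderiv ℝ (toricLift b z α) p (coordVec 1)] a : C3) k) =
      Matrix.of ![1, fun j => (α j (coordVec 0) * Complex.I : ℂ),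
        fun j => (α j (coordVec 1) * Complex.I : ℂ)] *
      (Matrix.diagonal (fun j => z j * Complex.exp (α j p * Complex.I)) *
        Matrix.of fun j k => b j k) := by
  ext a k
  rw [Matrix.mul_apply]
  simp only [Matrix.diagonal_mul, fderiv_toricLift]
  fin_cases a <;> simp [toricLift_apply, toricField, mul_assoc]

namespace IsToricDatum

theorem sum_eq_zero_iff {ι V : Type*} [Fintype ι] [NormedAddCommGroup V] [NormedSpace ℝ V]
    [FiniteDimensional ℝ V] {z : ι → ℂ} {α : ι → V →L[ℝ] ℝ} (h : IsToricDatum z α)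
    (hcard : Module.finrank ℝ V + 1 = Fintype.card ι) :
    ∑ j, α j = 0 ↔ ∀ j, (‖z j‖ ^ 2)⁻¹ = Fintype.card ι := by
  classical
  constructor
  · intro hsum k
    obtain ⟨v, hv⟩ := h.exists_dual_velocity hcard k
    have h0 : ∑ j, α j v = 0 := by rw [← sum_apply, hsum, zero_apply]
    simp only [hv, Finset.sum_sub_distrib, Finset.sum_pi_single', Finset.mem_univ, if_true,
      Finset.sum_const, Finset.card_univ, nsmul_one] at h0
    exact sub_eq_zero.1 h0
  · intro hz
    refine ContinuousLinearMap.ext fun v => ?_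
    have hbal := h.balanced v
    have hsq : ∀ j, ‖z j‖ ^ 2 = (Fintype.card ι : ℝ)⁻¹ := fun j => inv_eq_iff_eq_inv.1 (hz j)
    have hcard0 : (Fintype.card ι : ℝ)⁻¹ ≠ 0 := by
      rw [← hcard]
      positivity
    simp only [hsq, ← Finset.mul_sum] at hbal
    rw [sum_apply, zero_apply]
    exact (mul_eq_zero.1 hbal).resolve_left hcard0

variable {z : Fin 3 → ℂ} {α : Fin 3 → ℝ × ℝ →L[ℝ] ℝ} (h : IsToricDatum z α)
  (b : OrthonormalBasis (Fin 3) ℂ C3)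
include h

theorem sum_eq_zero_iff_norm_eq : ∑ j, α j = 0 ↔ ∀ j, ‖z j‖ = 1 / √3 := by
  rw [h.sum_eq_zero_iff (by simp), Fintype.card_fin, Nat.cast_ofNat]
  exact forall_congr' fun j => inv_sq_eq_iff (norm_nonneg _) zero_le_three

theorem meanCurvature_toricLift_eq_zero_iff (p : ℝ × ℝ) :
    meanCurvature (toricLift b z α) p = 0 ↔ ∀ j, ‖z j‖ = 1 / √3 := by
  rw [h.meanCurvature_toricLift, h.toricField_eq_zero_iff, funext_iff]
  refine forall_congr' fun j => ?_
  rw [Pi.zero_apply, Complex.ofReal_eq_zero, div_eq_zero_iff, or_iff_left two_ne_zero, sub_eq_zero,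
    eq_comm, inv_sq_eq_iff (norm_nonneg _) zero_le_three]

theorem expLagrangianAngle_toricLift (p : ℝ × ℝ) :
    expLagrangianAngle (toricLift b z α) p =
      expLagrangianAngle (toricLift b z α) 0 * Complex.exp ((∑ j, α j) p * Complex.I) := by
  have hprod : ∏ j, z j * Complex.exp (α j p * Complex.I) =
      (∏ j, z j * Complex.exp (α j 0 * Complex.I)) * Complex.exp ((∑ j, α j) p * Complex.I) := by
    simp only [Finset.prod_mul_distrib, ← Complex.exp_sum, ← Finset.sum_mul, sum_apply,
      Complex.ofReal_sum, map_zero, zero_mul, Complex.exp_zero, mul_one,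
      Complex.ofReal_zero]
  simp only [expLagrangianAngle, toricFrame_eq, Matrix.det_mul, Matrix.det_diagonal]
  rw [hprod, h.areaDensity_toricLift b p 0]
  ring

section Lifts

variable {b} {U : ℝ × ℝ → CP2} (hU : IsLift U Set.univ (toricLift b z α))
include hU

theorem isLagrangianImmersion : IsLagrangianImmersion U := by
  refine ⟨⟨fun p => ⟨_, _, Set.mem_univ p, hU⟩, fun W f hf p hp => ?_⟩,
    fun W f hf p hp v w => ?_⟩
  · rw [show dHor f p = fun v => _ from funext (hf.dHor_eq hU hp (Set.mem_univ p))]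
    have hc : transition f (toricLift b z α) p ≠ 0 :=
      norm_ne_zero_iff.1 ((hf.norm_transition hU hp (Set.mem_univ p)).trans_ne one_ne_zero)
    exact (smul_right_injective C3 hc).comp (h.injective_dHor_toricLift b p)
  · rw [kahler_eq, hf.dHor_eq hU hp (Set.mem_univ p), hf.dHor_eq hU hp (Set.mem_univ p),
      inner_smul_smul_of_norm_eq_one (hf.norm_transition hU hp (Set.mem_univ p)),
      h.inner_dHor_toricLift, Complex.ofReal_im, neg_zero]

end Lifts

variable {b} {u : Torus → CP2} (hu : IsLift (onPlane u) Set.univ (toricLift b z α))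
include hu

theorem isMinimal_iff : IsMinimal u ↔ ∀ j, ‖z j‖ = 1 / √3 := by
  refine ⟨fun hmin => (h.meanCurvature_toricLift_eq_zero_iff b 0).1
    (hmin _ _ hu 0 (Set.mem_univ _)), fun hz W f hf p hp => ?_⟩
  rw [hf.meanCurvature_eq hu hp (Set.mem_univ p),
    (h.meanCurvature_toricLift_eq_zero_iff b p).2 hz, smul_zero]

theorem sum_eq_zero_of_isSpecialLagrangian (hs : IsSpecialLagrangian u) : ∑ j, α j = 0 := by
  obtain ⟨c, hc⟩ := hs _ _ hu (h.isLegendrian_toricLift b _) isPreconnected_univ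
  have hne : expLagrangianAngle (toricLift b z α) 0 ≠ 0 :=
    (h.isLagrangianImmersion hu).expLagrangianAngle_ne_zero hu (h.isLegendrian_toricLift b _)
      (Set.mem_univ 0)
  have hconst : (fun p => Complex.exp ((∑ j, α j) p * Complex.I)) = fun _ => 1 := by
    ext1 p
    have hp := (hc p (Set.mem_univ _)).trans (hc 0 (Set.mem_univ _)).symm
    rw [h.expLagrangianAngle_toricLift] at hp
    exact mul_left_cancel₀ hne (hp.trans (mul_one _).symm)
  refine ContinuousLinearMap.ext fun v => ?_
  have hderiv := hasFDerivAt_exp_mul_I (∑ j, α j) 0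
  rw [hconst] at hderiv
  have hv := congrArg (fun L : ℝ × ℝ →L[ℝ] ℂ => L v)
    (hderiv.unique (hasFDerivAt_const (1 : ℂ) (0 : ℝ × ℝ)))
  refine Complex.ofReal_injective ?_
  simpa using hv

theorem isSpecialLagrangian_of_sum_eq_zero (hα : ∑ j, α j = 0) : IsSpecialLagrangian u := by
  intro W f hf hleg hW
  have hleg' := h.isLegendrian_toricLift b Set.univ
  obtain ⟨a, ha⟩ := hf.isOpen.exists_is_const_of_fderiv_eq_zero hW
    (fun p hp =>
      (hf.differentiableAt_transition hu hp (Set.mem_univ p)).differentiableWithinAt)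
    (fun p hp => hf.fderiv_transition_eq_zero hu hp (Set.mem_univ p) hleg hleg')
  refine ⟨a ^ 3 * expLagrangianAngle (toricLift b z α) 0, fun p hp => ?_⟩
  rw [hf.expLagrangianAngle_eq hu hp (Set.mem_univ p) hleg hleg', ha p hp,
    h.expLagrangianAngle_toricLift, hα, zero_apply, Complex.ofReal_zero, zero_mul,
    Complex.exp_zero, mul_one]

theorem isSpecialLagrangian_iff : IsSpecialLagrangian u ↔ ∀ j, ‖z j‖ = 1 / √3 := by
  rw [← h.sum_eq_zero_iff_norm_eq]
  exact ⟨h.sum_eq_zero_of_isSpecialLagrangian hu, h.isSpecialLagrangian_of_sum_eq_zero hu⟩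

end IsToricDatum

/-! ### Hamiltonian stationarity -/

theorem onC3_smul (k : CP2 → ℝ) {a : ℂ} (ha : a ≠ 0) (z : C3) : onC3 k (a • z) = onC3 k z := by
  by_cases hz : z = 0
  · rw [hz, smul_zero]
  · rw [onC3, onC3, dif_pos (smul_ne_zero ha hz), dif_pos hz]
    exact congrArg k ((Projectivization.mk_eq_mk_iff' ℂ _ _ _ _).2 ⟨a, rfl⟩)

namespace SmoothFun

variable {k : CP2 → ℝ} (hk : SmoothFun k) {z : C3} (hz : z ≠ 0)
include hk hz

theorem contDiffAt : ContDiffAt ℝ ∞ (onC3 k) z :=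
  ContDiffOn.contDiffAt hk (isOpen_compl_singleton.mem_nhds hz)

theorem differentiableAt : DifferentiableAt ℝ (onC3 k) z :=
  (hk.contDiffAt hz).differentiableAt (by simp)

theorem fderiv_onC3_smul {a : ℂ} (ha : a ≠ 0) (X : C3) :
    fderiv ℝ (onC3 k) (a • z) (a • X) = fderiv ℝ (onC3 k) z X := by
  have hcomp := (hk.differentiableAt (smul_ne_zero ha hz)).hasFDerivAt.comp z
    ((hasFDerivAt_id z).const_smul a)
  have hinvariant : onC3 k ∘ (fun w : C3 => a • w) = onC3 k := funext (onC3_smul k ha)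
  exact congrArg (fun L : C3 →L[ℝ] ℝ => L X)
    ((congrArg (fderiv ℝ · z) hinvariant).symm.trans hcomp.fderiv).symm

end SmoothFun

namespace IsLift

variable {U : ℝ × ℝ → CP2} {W : Set (ℝ × ℝ)} {f : ℝ × ℝ → C3} {p : ℝ × ℝ}

theorem ne_zero (hf : IsLift U W f) (hp : p ∈ W) : f p ≠ 0 :=
  norm_ne_zero_iff.1 ((hf.norm_eq_one hp).trans_ne one_ne_zero)

theorem onC3_eq (hf : IsLift U W f) (hp : p ∈ W) (k : CP2 → ℝ) : onC3 k (f p) = k (U p) := by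
  rw [onC3, dif_pos (hf.ne_zero hp), (mem_submodule_iff _).1 (hf.mem_submodule hp)]

theorem contDiff_comp (hf : IsLift U Set.univ f) {k : CP2 → ℝ} (hk : SmoothFun k) :
    ContDiff ℝ ∞ fun q => k (U q) := by
  simp only [← fun q => hf.onC3_eq (Set.mem_univ q) k]
  exact contDiff_iff_contDiffAt.2 fun p => (hk.contDiffAt (hf.ne_zero (Set.mem_univ p))).comp p
    (hf.contDiffAt (Set.mem_univ p))

end IsLift

theorem inner_hamiltonianField (k : CP2 → ℝ) (z X : C3) :
    inner ℝ X (hamiltonianField k z) = -fderiv ℝ (onC3 k) z (Complex.I • X) := by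
  have hgradient : fderiv ℝ (onC3 k) z (Complex.I • X) =
      (inner ℂ (gradient (onC3 k) z) (Complex.I • X) : ℂ).re := by
    rw [← toDual_gradient, InnerProductSpace.toDual_apply_apply]
    rfl
  have hre : inner ℝ X (hamiltonianField k z) =
      (inner ℂ (hamiltonianField k z) X : ℂ).re := real_inner_comm _ _
  rw [hgradient, hre, hamiltonianField, inner_smul_left, inner_smul_right]
  simp

theorem IsLift.variationDensity_eq {U : ℝ × ℝ → CP2} {W : Set (ℝ × ℝ)} {f : ℝ × ℝ → C3}
    {p : ℝ × ℝ} (hf : IsLift U W f) (hp : p ∈ W) {k : CP2 → ℝ} (hk : SmoothFun k) :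
    variationDensity U k p =
      -fderiv ℝ (onC3 k) (f p) (Complex.I • meanCurvature f p) * areaDensity f p := by
  obtain ⟨W', hp', hsome⟩ : ∃ W', p ∈ W' ∧ IsLift U W' (someLift U p) :=
    Classical.epsilon_spec (p := fun g => ∃ W', p ∈ W' ∧ IsLift U W' g) ⟨f, W, hp, hf⟩
  have hc : transition (someLift U p) f p ≠ 0 :=
    norm_ne_zero_iff.1 ((hsome.norm_transition hf hp' hp).trans_ne one_ne_zero)
  rw [variationDensity, inner_hamiltonianField, hsome.meanCurvature_eq hf hp' hp, smul_comm,
    hsome.areaDensity_eq hf hp' hp, hsome.eq_transition_smul hf hp' hp,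
    hk.fderiv_onC3_smul (hf.ne_zero hp) hc]

theorem integral_fderiv_eq_zero_of_periodic {φ : ℝ × ℝ → ℝ} (hφ : ContDiff ℝ 1 φ) {S T : ℝ}
    (hS : ∀ y, φ (S, y) = φ (0, y)) (hT : ∀ x, φ (x, T) = φ (x, 0)) (v : ℝ × ℝ) :
    ∫ x in (0 : ℝ)..S, ∫ y in (0 : ℝ)..T, fderiv ℝ φ (x, y) v = 0 := by
  have hderiv : ∀ p, HasFDerivAt φ (fderiv ℝ φ p) p := fun p =>
    (hφ.differentiable (by simp) p).hasFDerivAt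
  have hcont : Continuous (fderiv ℝ φ) := hφ.continuous_fderiv (by simp)
  have hv : ∀ p, fderiv ℝ φ p v =
      (v.1 • fderiv ℝ φ p) (1, 0) + (v.2 • fderiv ℝ φ p) (0, 1) := fun p =>
    (map_eq_sum_coordVec (fderiv ℝ φ p : ℝ × ℝ →ₗ[ℝ] ℝ).isLinear v).trans (Fin.sum_univ_two _)
  have hint : MeasureTheory.IntegrableOn
      (fun p => (v.1 • fderiv ℝ φ p) (1, 0) + (v.2 • fderiv ℝ φ p) (0, 1))
      (Set.uIcc 0 S ×ˢ Set.uIcc 0 T) :=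
    ContinuousOn.integrableOn_compact (isCompact_uIcc.prod isCompact_uIcc)
      (((hcont.const_smul v.1).clm_apply continuous_const).add
        ((hcont.const_smul v.2).clm_apply continuous_const)).continuousOn
  simp only [hv]
  rw [MeasureTheory.integral2_divergence_prod_of_hasFDerivAt (fun p => v.1 • φ p)
    (fun p => v.2 • φ p) (fun p => v.1 • fderiv ℝ φ p) (fun p => v.2 • fderiv ℝ φ p) 0 0 S T
    (hφ.continuous.const_smul v.1).continuousOn (hφ.continuous.const_smul v.2).continuousOn
    (fun p _ => (hderiv p).const_smul v.1) (fun p _ => (hderiv p).const_smul v.2) hint]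
  simp only [hS, hT, sub_self, zero_add]

namespace IsToricDatum

variable {z : Fin 3 → ℂ} {α : Fin 3 → ℝ × ℝ →L[ℝ] ℝ} (h : IsToricDatum z α)
  {b : OrthonormalBasis (Fin 3) ℂ C3}
include h

/-- The field `I • H` is the velocity of a one-parameter group of symmetries, so that the first
variations of the area are integrals of total derivatives. -/
theorem exists_I_smul_meanCurvature_eq_fderiv (b : OrthonormalBasis (Fin 3) ℂ C3) : ∃ v, ∀ p,
    Complex.I • meanCurvature (toricLift b z α) p = fderiv ℝ (toricLift b z α) p v := by
  have hθ : ∑ j, ‖z j‖ ^ 2 * ((3 - (‖z j‖ ^ 2)⁻¹) / 2) = 0 := by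
    have hterm : ∀ j, ‖z j‖ ^ 2 * ((3 - (‖z j‖ ^ 2)⁻¹) / 2) = 3 / 2 * ‖z j‖ ^ 2 - 1 / 2 :=
      fun j => by linear_combination (-1 / 2) * mul_inv_cancel₀ (h.sq_norm_ne_zero j)
    simp only [hterm, Finset.sum_sub_distrib, ← Finset.mul_sum, h.sum_sq, Finset.sum_const,
      Finset.card_univ, Fintype.card_fin]
    norm_num
  obtain ⟨v, hv⟩ := h.exists_velocity (by simp) hθ
  refine ⟨v, fun p => ?_⟩
  rw [h.meanCurvature_toricLift, fderiv_toricLift, ← toricField_smul]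
  congr 1 with j
  rw [hv, Pi.smul_apply, smul_eq_mul, mul_comm]

theorem exists_variationDensity_eq {U : ℝ × ℝ → CP2} (hU : IsLift U Set.univ (toricLift b z α)) :
    ∃ v : ℝ × ℝ, ∀ k : CP2 → ℝ, SmoothFun k → ∀ p,
      variationDensity U k p = fderiv ℝ (fun q => k (U q)) p v := by
  obtain ⟨v, hv⟩ := h.exists_I_smul_meanCurvature_eq_fderiv b
  refine ⟨-areaDensity (toricLift b z α) 0 • v, fun k hk p => ?_⟩
  have heq : (fun q => k (U q)) = onC3 k ∘ toricLift b z α :=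
    funext fun q => (hU.onC3_eq (Set.mem_univ q) k).symm
  rw [hU.variationDensity_eq (Set.mem_univ p) hk, hv, heq,
    fderiv_comp p (hk.differentiableAt (hU.ne_zero (Set.mem_univ p)))
      (hU.differentiableAt (Set.mem_univ p)),
    h.areaDensity_toricLift b p 0, ContinuousLinearMap.comp_apply, map_smul, map_smul, smul_eq_mul]
  ring

theorem isHamiltonianStationary {u : Torus → CP2}
    (hu : IsLift (onPlane u) Set.univ (toricLift b z α)) : IsHamiltonianStationary u := by
  intro k hk
  obtain ⟨v, hv⟩ := h.exists_variationDensity_eq hu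
  simp only [hv k hk]
  refine integral_fderiv_eq_zero_of_periodic ((hu.contDiff_comp hk).of_le (by simp))
    (fun y => ?_) (fun x => ?_) v <;>
  simp [onPlane, AddCircle.coe_period]

end IsToricDatum

/-! ### Linear flows -/

section Flow

variable {E : Type*} [NormedAddCommGroup E] [NormedSpace ℂ E]

/-- The flow `e^{tT}` of the linear vector field `T`, with real time and complex linear `T`. -/
def flow (T : E →L[ℂ] E) (t : ℝ) : E →L[ℂ] E := NormedSpace.exp ((t : ℂ) • T)

theorem flow_zero (T : E →L[ℂ] E) : flow T 0 = 1 := by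
  rw [flow, Complex.ofReal_zero, zero_smul, NormedSpace.exp_zero]

theorem flow_neg_left (T : E →L[ℂ] E) (t : ℝ) : flow (-T) t = flow T (-t) := by
  rw [flow, flow, Complex.ofReal_neg, neg_smul, smul_neg]

variable [CompleteSpace E]

theorem flow_neg_apply_flow_apply (T : E →L[ℂ] E) (t : ℝ) (w : E) :
    flow T (-t) (flow T t w) = w := by
  let _ : NormedAlgebra ℚ (E →L[ℂ] E) := NormedAlgebra.restrictScalars ℚ ℂ _
  have hinv : flow T (-t) * flow T t = 1 := by
    rw [flow, flow, Complex.ofReal_neg, neg_smul,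
      ← NormedSpace.exp_add_of_commute (Commute.refl ((t : ℂ) • T)).neg_left, neg_add_cancel,
      NormedSpace.exp_zero]
  exact DFunLike.congr_fun hinv w

theorem hasDerivAt_flow_apply (T : E →L[ℂ] E) {γ : ℝ → E} {γ' : E} (hγ : HasDerivAt γ γ' 0) :
    HasDerivAt (fun t => flow T t (γ t)) (T (γ 0) + γ') 0 := by
  have hexp : HasDerivAt (fun u : ℂ => NormedSpace.exp (u • T)) T ((0 : ℝ) : ℂ) := by
    simpa using hasDerivAt_exp_smul_const (𝕂 := ℂ) T ((0 : ℝ) : ℂ)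
  have hflow : HasDerivAt (flow T) T 0 := by
    have h := hexp.scomp (0 : ℝ) Complex.ofRealCLM.hasDerivAt
    rwa [Complex.ofRealCLM_apply, Complex.ofReal_one, one_smul] at h
  have hreal : HasDerivAt (fun t => (flow T t).restrictScalars ℝ) (T.restrictScalars ℝ) 0 :=
    (ContinuousLinearMap.restrictScalarsL ℂ E E ℝ ℝ).hasFDerivAt.comp_hasDerivAt _ hflow
  simpa [flow_zero] using hreal.clm_apply hγ

theorem hasDerivAt_clm_flow_apply {F : Type*} [NormedAddCommGroup F] [NormedSpace ℂ F]
    (L : E →L[ℂ] F) (T : E →L[ℂ] E) (w : E) :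
    HasDerivAt (fun t => L (flow T t w)) (L (T w)) 0 := by
  have h := hasDerivAt_flow_apply T (hasDerivAt_const (0 : ℝ) w)
  rw [add_zero] at h
  exact (L.restrictScalars ℝ).hasFDerivAt.comp_hasDerivAt _ h

theorem hasDerivAt_flow_conj (T M : E →L[ℂ] E) (w : E) :
    HasDerivAt (fun t => flow T (-t) (M (flow T t w))) (M (T w) - T (M w)) 0 := by
  have h := hasDerivAt_flow_apply (-T) (hasDerivAt_clm_flow_apply M T w)
  simp only [flow_neg_left, flow_zero, one_apply_eq_self, neg_apply] at h
  rwa [neg_add_eq_sub] at h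

theorem flow_apply_of_apply_eq_smul {T : E →L[ℂ] E} {μ : ℂ} {w : E} (h : T w = μ • w) (t : ℝ) :
    flow T t w = Complex.exp (t * μ) • w := by
  have hpow : ∀ n : ℕ, (((t : ℂ) • T) ^ n) w = ((t : ℂ) * μ) ^ n • w := by
    intro n
    induction n with
    | zero => simp
    | succ n ih =>
      rw [pow_succ', mul_apply_eq_comp, ih, map_smul, smul_apply, h, smul_smul, smul_smul,
        pow_succ, mul_assoc]
  have hflow := (NormedSpace.exp_series_hasSum_exp' (𝕂 := ℂ) ((t : ℂ) • T)).mapL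
    (ContinuousLinearMap.apply ℂ E w)
  have hscalar := (NormedSpace.exp_series_hasSum_exp' (𝕂 := ℂ) ((t : ℂ) * μ)).smul_const w
  rw [← Complex.exp_eq_exp_ℂ] at hscalar
  refine hflow.unique ?_
  convert hscalar using 2 with n
  rw [ContinuousLinearMap.apply_apply, smul_apply, hpow, smul_eq_mul, mul_smul]

end Flow

theorem mem_submodule_of_hasDerivAt {E : Type*} [NormedAddCommGroup E] [NormedSpace ℂ E]
    (P : Submodule ℂ E) [FiniteDimensional ℂ P] {γ : ℝ → E} {γ' : E} {t : ℝ}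
    (hγ : HasDerivAt γ γ' t) (hmem : ∀ᶠ s in 𝓝 t, γ s ∈ P) : γ' ∈ P := by
  refine P.closed_of_finiteDimensional.mem_of_tendsto (hasDerivAt_iff_tendsto_slope.1 hγ) ?_
  filter_upwards [hmem.filter_mono nhdsWithin_le_nhds] with s hs
  rw [slope_def_module]
  exact P.smul_of_tower_mem _ (P.sub_mem hs hmem.self_of_nhds)

/-! ### Skew-adjoint operators -/

section SkewAdjoint

variable {E : Type*} [NormedAddCommGroup E] [InnerProductSpace ℂ E] [CompleteSpace E]

theorem inner_apply_left_of_mem_skewAdjoint {T : E →L[ℂ] E} (hT : T ∈ skewAdjoint (E →L[ℂ] E))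
    (x y : E) : (inner ℂ (T x) y : ℂ) = -inner ℂ x (T y) := by
  rw [← ContinuousLinearMap.adjoint_inner_right, ← ContinuousLinearMap.star_eq_adjoint,
    skewAdjoint.mem_iff.1 hT, neg_apply, inner_neg_right]

theorem re_inner_apply_self_of_mem_skewAdjoint {T : E →L[ℂ] E}
    (hT : T ∈ skewAdjoint (E →L[ℂ] E)) (x : E) : (inner ℂ x (T x) : ℂ).re = 0 := by
  have h := congrArg Complex.re (inner_apply_left_of_mem_skewAdjoint hT x x)
  rw [← inner_conj_symm, Complex.conj_re, Complex.neg_re] at h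
  linarith

theorem inner_commutator_apply_self {S T : E →L[ℂ] E} (hS : S ∈ skewAdjoint (E →L[ℂ] E))
    (hT : T ∈ skewAdjoint (E →L[ℂ] E)) (x : E) :
    (inner ℂ x (S (T x) - T (S x)) : ℂ) = -(2 * (inner ℂ (S x) (T x) : ℂ).im * Complex.I) := by
  have hST := inner_apply_left_of_mem_skewAdjoint hS x (T x)
  have hTS := inner_apply_left_of_mem_skewAdjoint hT x (S x)
  have hconj := Complex.sub_conj (inner ℂ (S x) (T x) : ℂ)
  rw [inner_conj_symm] at hconj
  rw [inner_sub_right]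
  push_cast at hconj
  linear_combination hST - hTS - hconj

theorem isSymmetric_neg_I_smul_of_mem_skewAdjoint {T : E →L[ℂ] E}
    (hT : T ∈ skewAdjoint (E →L[ℂ] E)) :
    ((-Complex.I • T : E →L[ℂ] E) : E →ₗ[ℂ] E).IsSymmetric := by
  intro x y
  have h := inner_apply_left_of_mem_skewAdjoint hT x y
  change inner ℂ (-Complex.I • T x) y = inner ℂ x (-Complex.I • T y)
  rw [inner_smul_left, inner_smul_right, h]
  simp

end SkewAdjoint

section JointEigenbasis

variable {𝕜 E : Type*} [RCLike 𝕜] [NormedAddCommGroup E] [InnerProductSpace 𝕜 E]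
  [FiniteDimensional 𝕜 E] {n : ℕ}

theorem exists_joint_eigenbasis_of_isSymmetric (hn : Module.finrank 𝕜 E = n) {S T : E →ₗ[𝕜] E}
    (hS : S.IsSymmetric) (hT : T.IsSymmetric) (hST : Commute S T) :
    ∃ (b : OrthonormalBasis (Fin n) 𝕜 E) (s t : Fin n → ℝ),
      (∀ j, S (b j) = (s j : 𝕜) • b j) ∧ ∀ j, T (b j) = (t j : 𝕜) • b j := by
  classical
  let joint (i : 𝕜 × 𝕜) := Module.End.eigenspace S i.2 ⊓ Module.End.eigenspace T i.1
  have hint : DirectSum.IsInternal joint := hS.directSum_isInternal_of_commute hT hST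
  have hfin := WellFoundedGT.finite_ne_bot_of_iSupIndep hint.submodule_iSupIndep
  have : Fintype {i // joint i ≠ ⊥} := hfin.fintype
  have horth := (hS.orthogonalFamily_eigenspace_inf_eigenspace hT).comp
    (Subtype.val_injective (p := fun i => joint i ≠ ⊥))
  have hint' := DirectSum.isInternal_ne_bot_iff.2 hint
  let b := hint'.subordinateOrthonormalBasis hn horth
  have hb : ∀ j, ∃ i, b j ∈ joint i :=
    fun j => ⟨_, hint'.subordinateOrthonormalBasis_subordinate hn j horth⟩
  have hreal {R : E →ₗ[𝕜] E} (hR : R.IsSymmetric) (j : Fin n) {μ : 𝕜}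
      (h : b j ∈ Module.End.eigenspace R μ) : R (b j) = (RCLike.re μ : 𝕜) • b j := by
    have hμ := hR.conj_eigenvalue_eq_self
      (Module.End.hasEigenvalue_of_hasEigenvector ⟨h, b.orthonormal.ne_zero j⟩)
    rw [RCLike.conj_eq_iff_re.1 hμ]
    exact Module.End.mem_eigenspace_iff.1 h
  choose i hi using hb
  exact ⟨b, fun j => RCLike.re (i j).2, fun j => RCLike.re (i j).1,
    fun j => hreal hS j (hi j).1, fun j => hreal hT j (hi j).2⟩

end JointEigenbasis

theorem exists_joint_eigenbasis_of_mem_skewAdjoint {E : Type*} [NormedAddCommGroup E]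
    [InnerProductSpace ℂ E] [FiniteDimensional ℂ E] [CompleteSpace E] {n : ℕ}
    (hn : Module.finrank ℂ E = n) {S T : E →L[ℂ] E} (hS : S ∈ skewAdjoint (E →L[ℂ] E))
    (hT : T ∈ skewAdjoint (E →L[ℂ] E)) (hST : ∀ x, S (T x) = T (S x)) :
    ∃ (b : OrthonormalBasis (Fin n) ℂ E) (s t : Fin n → ℝ),
      (∀ j, S (b j) = (s j * Complex.I) • b j) ∧ ∀ j, T (b j) = (t j * Complex.I) • b j := by
  obtain ⟨b, s, t, hs, ht⟩ := exists_joint_eigenbasis_of_isSymmetric hn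
    (isSymmetric_neg_I_smul_of_mem_skewAdjoint hS) (isSymmetric_neg_I_smul_of_mem_skewAdjoint hT)
    (LinearMap.ext fun x => by simp [hST])
  have hI {R : E →L[ℂ] E} {a : ℝ} {x : E} (h : -Complex.I • R x = (a : ℂ) • x) :
      R x = (a * Complex.I) • x := by
    rw [mul_comm, mul_smul, ← h, smul_smul]
    simp
  exact ⟨b, s, t, fun j => hI (hs j), fun j => hI (ht j)⟩

/-! ### Equivariant maps -/

/-- The map `U` intertwines the translations in the direction `v` with the flow of `T` on complex
lines: `U (p + t v) = e^{tT} U p`. -/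
def IsFlowEquivariant {V E : Type*} [AddCommGroup V] [Module ℝ V] [NormedAddCommGroup E]
    [NormedSpace ℂ E] (U : V → ℙ ℂ E) (v : V) (T : E →L[ℂ] E) : Prop :=
  ∀ p t, ∀ w ∈ (U p).submodule, flow T t w ∈ (U (p + t • v)).submodule

namespace IsFlowEquivariant

section Commutator

variable {V E : Type*} [AddCommGroup V] [Module ℝ V] [NormedAddCommGroup E] [NormedSpace ℂ E]
  {U : V → ℙ ℂ E} {v v' p : V} {S T : E →L[ℂ] E} {w : E}

theorem flow_neg_apply_mem (hT : IsFlowEquivariant U v T) {t : ℝ}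
    (hw : w ∈ (U (p + t • v)).submodule) : flow T (-t) w ∈ (U p).submodule := by
  simpa using hT _ (-t) w hw

variable [CompleteSpace E]

/-- Differentiate the conjugated flow at zero in the time of `S`, then in the time of `T`. -/
theorem commutator_apply_mem (hS : IsFlowEquivariant U v S) (hT : IsFlowEquivariant U v' T)
    (hw : w ∈ (U p).submodule) : S (T w) - T (S w) ∈ (U p).submodule := by
  have hgroup : ∀ s t, flow S (-s) (flow T t (flow S s w)) ∈ (U (p + t • v')).submodule := by
    intro s t
    have h := hT _ t _ (hS p s w hw)
    rw [add_right_comm] at h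
    exact hS.flow_neg_apply_mem h
  have hfst : ∀ t, flow T t (S w) - S (flow T t w) ∈ (U (p + t • v')).submodule := fun t =>
    mem_submodule_of_hasDerivAt _ (hasDerivAt_flow_conj S (flow T t) w)
      (.of_forall fun s => hgroup s t)
  have hconj : ∀ t, S w - flow T (-t) (S (flow T t w)) ∈ (U p).submodule := fun t => by
    have h := hT.flow_neg_apply_mem (hfst t)
    rwa [map_sub, flow_neg_apply_flow_apply] at h
  have hsnd := mem_submodule_of_hasDerivAt _ ((hasDerivAt_flow_conj T S w).const_sub (S w))
    (.of_forall hconj)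
  exact neg_mem_iff.1 hsnd

end Commutator

variable {U : ℝ × ℝ → CP2} {W : Set (ℝ × ℝ)} {f : ℝ × ℝ → C3} {p v v' : ℝ × ℝ}
  {S T : C3 →L[ℂ] C3}

theorem dHor_eq (hT : IsFlowEquivariant U v T) (hf : IsLift U W f) (hp : p ∈ W) :
    dHor f p v = hor (f p) (T (f p)) := by
  have hline : HasDerivAt (fun t : ℝ => p + t • v) v 0 := by
    simpa using ((hasDerivAt_id (0 : ℝ)).smul_const v).const_add p
  have hf' : HasFDerivAt f (fderiv ℝ f p) (p + (0 : ℝ) • v) := by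
    simpa using (hf.differentiableAt hp).hasFDerivAt
  have hcurve := hasDerivAt_flow_apply (-T) (hf'.comp_hasDerivAt (0 : ℝ) hline)
  simp only [Function.comp_apply, flow_neg_left, zero_smul, add_zero, neg_apply] at hcurve
  have hW : ∀ᶠ t : ℝ in 𝓝 0, p + t • v ∈ W :=
    hline.continuousAt.eventually_mem (hf.isOpen.mem_nhds (by simpa using hp))
  have hmem := mem_submodule_of_hasDerivAt (U p).submodule hcurve
    (hW.mono fun t ht => hT.flow_neg_apply_mem (hf.mem_submodule ht))
  have hvert := eq_inner_smul_of_mem_submodule (hf.norm_eq_one hp) (hf.mem_submodule hp) hmem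
  rw [neg_add_eq_sub, sub_eq_iff_eq_add] at hvert
  rw [dHor, hvert, hor_add, hor_smul, hor_self (hf.norm_eq_one hp), smul_zero, zero_add]

theorem commutator_apply_eq_zero (hU : IsLagrangianImmersion U) (hS : IsFlowEquivariant U v S)
    (hT : IsFlowEquivariant U v' T) (hSadj : S ∈ skewAdjoint (C3 →L[ℂ] C3))
    (hTadj : T ∈ skewAdjoint (C3 →L[ℂ] C3)) {w : C3} (hw : w ∈ (U p).submodule) :
    S (T w) - T (S w) = 0 := by
  obtain ⟨W, f, hp, hf⟩ := hU.1.1 p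
  have hnorm := hf.norm_eq_one hp
  have hlagrangian : (inner ℂ (S (f p)) (T (f p)) : ℂ).im = 0 := by
    have h := hU.im_inner_dHor_dHor hf hp v v'
    rw [hS.dHor_eq hf hp, hT.dHor_eq hf hp, inner_hor_hor _ _ hnorm,
      ← inner_conj_symm (S (f p)) (f p), Complex.sub_im, Complex.mul_im, Complex.conj_re,
      re_inner_apply_self_of_mem_skewAdjoint hSadj, re_inner_apply_self_of_mem_skewAdjoint hTadj,
      zero_mul, mul_zero, add_zero, sub_zero] at h
    exact h
  have hcomm := eq_inner_smul_of_mem_submodule hnorm (hf.mem_submodule hp)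
    (hS.commutator_apply_mem hT (hf.mem_submodule hp))
  rw [inner_commutator_apply_self hSadj hTadj, hlagrangian, Complex.ofReal_zero, mul_zero,
    zero_mul, neg_zero, zero_smul] at hcomm
  rw [eq_inner_smul_of_mem_submodule hnorm (hf.mem_submodule hp) hw, map_smul, map_smul,
    map_smul, map_smul, ← smul_sub, hcomm, smul_zero]

end IsFlowEquivariant

section Frame

variable {U : ℝ × ℝ → CP2} {W : Set (ℝ × ℝ)} {f : ℝ × ℝ → C3} {p : ℝ × ℝ} {S T : C3 →L[ℂ] C3}
  (hU : IsLagrangianImmersion U) (hS : IsFlowEquivariant U (coordVec 0) S)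
  (hT : IsFlowEquivariant U (coordVec 1) T)
include hU hS hT

theorem IsLagrangianImmersion.eq_zero_of_frame {F : Type*} [AddCommGroup F] [Module ℂ F]
    (hf : IsLift U W f) (hp : p ∈ W) {L : C3 →ₗ[ℂ] F} (h0 : L (f p) = 0) (h1 : L (S (f p)) = 0)
    (h2 : L (T (f p)) = 0) : L = 0 := by
  have hframe := hU.linearIndependent_frame hf hp
  rw [hS.dHor_eq hf hp, hT.dHor_eq hf hp] at hframe
  refine (basisOfLinearIndependentOfCardEqFinrank hframe (by simp)).ext fun i => ?_
  rw [coe_basisOfLinearIndependentOfCardEqFinrank]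
  fin_cases i <;> simp [hor_eq, h0, h1, h2]

theorem IsLagrangianImmersion.commute_of_isFlowEquivariant
    (hSadj : S ∈ skewAdjoint (C3 →L[ℂ] C3)) (hTadj : T ∈ skewAdjoint (C3 →L[ℂ] C3)) (x : C3) :
    S (T x) = T (S x) := by
  obtain ⟨W, f, hp, hf⟩ := hU.1.1 0
  let C : C3 →L[ℂ] C3 := S * T - T * S
  have hC {p w} (hw : w ∈ (U p).submodule) : C w = 0 :=
    hS.commutator_apply_eq_zero hU hT hSadj hTadj hw
  have hC' {v} {R : C3 →L[ℂ] C3} (hR : IsFlowEquivariant U v R) : C (R (f 0)) = 0 := by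
    have hconst : (fun t => C (flow R t (f 0))) = fun _ => 0 :=
      funext fun t => hC (hR 0 t _ (hf.mem_submodule hp))
    have h := hasDerivAt_clm_flow_apply C R (f 0)
    rw [hconst] at h
    exact h.unique (hasDerivAt_const 0 0)
  have hzero : (C : C3 →ₗ[ℂ] C3) = 0 :=
    hU.eq_zero_of_frame hS hT hf hp (hC (hf.mem_submodule hp)) (hC' hS) (hC' hT)
  exact sub_eq_zero.1 (LinearMap.congr_fun hzero x)

end Frame

/-! ### Horizontal toric lifts -/

section BalancedPhase

variable {ι V : Type*} [Fintype ι] [NormedAddCommGroup V] [NormedSpace ℝ V] {z : ι → ℂ}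

/-- The phases `β` shifted by their mean with respect to the weights `‖z j‖ ^ 2`. The shift turns
the orbit `toricLift b z β` into a horizontal one over the same complex lines. -/
def balancedPhase (z : ι → ℂ) (β : ι → V →L[ℝ] ℝ) (j : ι) : V →L[ℝ] ℝ :=
  β j - ∑ k, ‖z k‖ ^ 2 • β k

theorem sum_sq_norm_mul_balancedPhase (hz : ∑ j, ‖z j‖ ^ 2 = 1) (β : ι → V →L[ℝ] ℝ) (v : V) :
    ∑ j, ‖z j‖ ^ 2 * balancedPhase z β j v = 0 := by
  simp only [balancedPhase, sub_apply, sum_apply, smul_apply, smul_eq_mul, mul_sub,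
    Finset.sum_sub_distrib, ← Finset.sum_mul, hz, one_mul, sub_self]

theorem toricLift_balancedPhase {E : Type*} [NormedAddCommGroup E] [InnerProductSpace ℂ E]
    (b : OrthonormalBasis ι ℂ E) (β : ι → V →L[ℝ] ℝ) (p : V) :
    toricLift b z (balancedPhase z β) p =
      Complex.exp (-((∑ k, ‖z k‖ ^ 2 • β k) p * Complex.I)) • toricLift b z β p := by
  simp only [toricLift_apply, Finset.smul_sum, smul_smul]
  refine Finset.sum_congr rfl fun j _ => ?_
  rw [mul_left_comm, ← Complex.exp_add, balancedPhase, sub_apply, Complex.ofReal_sub, sub_mul,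
    neg_add_eq_sub]

variable {U : ℝ × ℝ → CP2} {z : Fin 3 → ℂ} {β : Fin 3 → (ℝ × ℝ) →L[ℝ] ℝ}
  {b : OrthonormalBasis (Fin 3) ℂ C3}

theorem isLift_toricLift_balancedPhase (hz : ∑ j, ‖z j‖ ^ 2 = 1)
    (hmem : ∀ p, toricLift b z β p ∈ (U p).submodule) :
    IsLift U Set.univ (toricLift b z (balancedPhase z β)) :=
  .of_mem_submodule isOpen_univ (contDiff_toricField b z _ 1).contDiffOn
    (fun p _ => norm_toricLift b _ p hz) fun p _ =>
      toricLift_balancedPhase b β p ▸ Submodule.smul_mem _ _ (hmem p)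

theorem eq_zero_of_toricLift (hU : IsImmersion U) {α : Fin 3 → (ℝ × ℝ) →L[ℝ] ℝ}
    (hlift : IsLift U Set.univ (toricLift b z α)) {v : ℝ × ℝ} (hv : ∀ j, α j v = 0) : v = 0 := by
  refine hU.2 _ _ hlift 0 (Set.mem_univ 0) ?_
  simp only [dHor, fderiv_toricLift, toricField, hv, hor_eq]
  simp

end BalancedPhase

section JointFlow

variable {ι E : Type*} [Fintype ι] [NormedAddCommGroup E] [InnerProductSpace ℂ E] [CompleteSpace E]
  {S T : E →L[ℂ] E} {b : OrthonormalBasis ι ℂ E} {s t : ι → ℝ}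

theorem flow_flow_apply_eq_toricLift (hs : ∀ j, S (b j) = (s j * Complex.I) • b j)
    (ht : ∀ j, T (b j) = (t j * Complex.I) • b j) (w : E) (p : ℝ × ℝ) :
    flow S p.1 (flow T p.2 w) = toricLift b (fun j => inner ℂ (b j) w)
      (fun j => s j • .fst ℝ ℝ ℝ + t j • .snd ℝ ℝ ℝ) p := by
  nth_rw 1 [← b.sum_repr' w]
  rw [map_sum, map_sum, toricLift_apply]
  refine Finset.sum_congr rfl fun j _ => ?_
  rw [map_smul, map_smul, flow_apply_of_apply_eq_smul (ht j), map_smul,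
    flow_apply_of_apply_eq_smul (hs j), smul_smul, smul_smul, mul_assoc, ← Complex.exp_add]
  congr 3
  simp only [add_apply, smul_apply, ContinuousLinearMap.coe_fst', ContinuousLinearMap.coe_snd',
    smul_eq_mul]
  push_cast
  ring

end JointFlow

theorem IsLagrangianImmersion.exists_toricLift {U : ℝ × ℝ → CP2} {S T : C3 →L[ℂ] C3}
    (hU : IsLagrangianImmersion U) (hS : IsFlowEquivariant U (coordVec 0) S)
    (hT : IsFlowEquivariant U (coordVec 1) T) (hSadj : S ∈ skewAdjoint (C3 →L[ℂ] C3))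
    (hTadj : T ∈ skewAdjoint (C3 →L[ℂ] C3)) :
    ∃ (b : OrthonormalBasis (Fin 3) ℂ C3) (z : Fin 3 → ℂ) (α : Fin 3 → (ℝ × ℝ) →L[ℝ] ℝ),
      IsToricDatum z α ∧ IsLift U Set.univ (toricLift b z α) := by
  obtain ⟨b, s, t, hs, ht⟩ := exists_joint_eigenbasis_of_mem_skewAdjoint finrank_euclideanSpace_fin
    hSadj hTadj (hU.commute_of_isFlowEquivariant hS hT hSadj hTadj)
  obtain ⟨W, f, hp, hf⟩ := hU.1.1 0
  let z : Fin 3 → ℂ := fun j => inner ℂ (b j) (f 0)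
  let β : Fin 3 → (ℝ × ℝ) →L[ℝ] ℝ := fun j => s j • .fst ℝ ℝ ℝ + t j • .snd ℝ ℝ ℝ
  have hz : ∑ j, ‖z j‖ ^ 2 = 1 := by
    rw [b.sum_sq_norm_inner_right, hf.norm_eq_one hp, one_pow]
  have hz0 : ∀ j, z j ≠ 0 := by
    intro j hj
    have hL {R : C3 →L[ℂ] C3} (hR : R ∈ skewAdjoint (C3 →L[ℂ] C3)) {μ : ℂ}
        (hμ : R (b j) = μ • b j) : innerSL ℂ (b j) (R (f 0)) = 0 := by
      have h := inner_apply_left_of_mem_skewAdjoint hR (b j) (f 0)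
      rw [hμ, inner_smul_left, show inner ℂ (b j) (f 0) = 0 from hj, mul_zero] at h
      exact neg_eq_zero.1 h.symm
    have hzero : (innerSL ℂ (b j) : C3 →ₗ[ℂ] ℂ) = 0 :=
      hU.eq_zero_of_frame hS hT hf hp hj (hL hSadj (hs j)) (hL hTadj (ht j))
    exact b.orthonormal.ne_zero j (inner_self_eq_zero.1 (LinearMap.congr_fun hzero (b j)))
  have hmem : ∀ p, toricLift b z β p ∈ (U p).submodule := by
    intro p
    rw [← flow_flow_apply_eq_toricLift hs ht]
    have h := hS _ p.1 _ (hT 0 p.2 _ (hf.mem_submodule hp))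
    simpa [coordVec] using h
  have hlift := isLift_toricLift_balancedPhase hz hmem
  exact ⟨b, z, balancedPhase z β, ⟨hz0, hz, sum_sq_norm_mul_balancedPhase hz β,
    fun _ => eq_zero_of_toricLift hU.1 hlift⟩, hlift⟩

section Matrix

variable {n : Type*} [Fintype n] [DecidableEq n]

open scoped Matrix.Norms.Operator in
theorem toEuclideanLin_exp (A : Matrix n n ℂ) (w : EuclideanSpace ℂ n) :
    Matrix.toEuclideanLin (NormedSpace.exp A) w =
      NormedSpace.exp (Matrix.toEuclideanCLM (𝕜 := ℂ) A) w := by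
  have hcont : Continuous (Matrix.toEuclideanCLM (n := n) (𝕜 := ℂ)) :=
    LinearMap.continuous_of_finiteDimensional (Matrix.toEuclideanCLM (n := n) (𝕜 := ℂ) :
      Matrix n n ℂ →ₐ[ℂ] EuclideanSpace ℂ n →L[ℂ] EuclideanSpace ℂ n).toLinearMap
  rw [← NormedSpace.map_exp _ hcont A]
  rfl

theorem toEuclideanCLM_mem_skewAdjoint {A : Matrix n n ℂ} (hA : A.conjTranspose = -A) :
    Matrix.toEuclideanCLM (𝕜 := ℂ) A ∈
      skewAdjoint (EuclideanSpace ℂ n →L[ℂ] EuclideanSpace ℂ n) := by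
  rw [skewAdjoint.mem_iff, ← map_star, Matrix.star_eq_conjTranspose, hA, map_neg]

end Matrix

theorem map_mem_submodule_map_iff {K E F : Type*} [Field K] [AddCommGroup E] [Module K E]
    [AddCommGroup F] [Module K F] {L : E →ₗ[K] F} (hL : Function.Injective L) {P : ℙ K E} {w : E} :
    L w ∈ (P.map L hL).submodule ↔ w ∈ P.submodule := by
  induction P with
  | h v hv =>
    simp only [Projectivization.map_mk, Projectivization.submodule_mk,
      Submodule.mem_span_singleton, ← map_smul, hL.eq_iff]

theorem toEuclideanLin_mem_submodule_projAct_iff {M : Matrix (Fin 3) (Fin 3) ℂ} (hM : IsUnit M)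
    {P : CP2} {w : C3} :
    Matrix.toEuclideanLin M w ∈ (projAct M hM P).submodule ↔ w ∈ P.submodule :=
  map_mem_submodule_map_iff (toEuclideanLin_injective hM)

theorem flow_mem_submodule_expAct_iff (A : Matrix (Fin 3) (Fin 3) ℂ) (t : ℝ) {P : CP2} {w : C3} :
    flow (Matrix.toEuclideanCLM (𝕜 := ℂ) A) t w ∈ (expAct A t P).submodule ↔ w ∈ P.submodule := by
  rw [flow, ← map_smul, ← toEuclideanLin_exp]
  exact toEuclideanLin_mem_submodule_projAct_iff _

theorem IsHomogeneous.exists_isFlowEquivariant {u : Torus → CP2} (hu : IsHomogeneous u) :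
    ∃ S ∈ skewAdjoint (C3 →L[ℂ] C3), ∃ T ∈ skewAdjoint (C3 →L[ℂ] C3),
      IsFlowEquivariant (onPlane u) (coordVec 0) S ∧
        IsFlowEquivariant (onPlane u) (coordVec 1) T := by
  obtain ⟨A, B, hA, hB, huA, huB⟩ := hu
  refine ⟨_, toEuclideanCLM_mem_skewAdjoint hA, _, toEuclideanCLM_mem_skewAdjoint hB,
    fun p t w hw => ?_, fun p t w hw => ?_⟩
  · have h := huA p.1 p.2 t ▸ (flow_mem_submodule_expAct_iff A t).2 hw
    simpa [onPlane, coordVec] using h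
  · have h := huB p.1 p.2 t ▸ (flow_mem_submodule_expAct_iff B t).2 hw
    simpa [onPlane, coordVec] using h

theorem IsHomogeneous.exists_toricLift {u : Torus → CP2} (hu : IsHomogeneous u)
    (hL : IsLagrangianImmersion (onPlane u)) :
    ∃ (b : OrthonormalBasis (Fin 3) ℂ C3) (z : Fin 3 → ℂ) (α : Fin 3 → (ℝ × ℝ) →L[ℝ] ℝ),
      IsToricDatum z α ∧ IsLift (onPlane u) Set.univ (toricLift b z α) := by
  obtain ⟨S, hS, T, hT, hSu, hTu⟩ := hu.exists_isFlowEquivariant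
  exact hL.exists_toricLift hSu hTu hS hT

/-! ### Torus images and their radii -/

theorem eq_of_mem_submodule {E : Type*} [NormedAddCommGroup E] [InnerProductSpace ℂ E]
    {P Q : ℙ ℂ E} {w : E} (hw : w ≠ 0) (hP : w ∈ P.submodule) (hQ : w ∈ Q.submodule) : P = Q :=
  ((mem_submodule_iff hw).1 hP).symm.trans ((mem_submodule_iff hw).1 hQ)

theorem sq_eq_norm_sq_add_sum_of_forall_sign {ι F : Type*} [NormedAddCommGroup F]
    [InnerProductSpace ℝ F] {x : ι → F} {ρ : ℝ} (s : Finset ι) {y : F}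
    (h : ∀ ε : ι → ℝ, (∀ j, |ε j| = 1) → ‖y + ∑ j ∈ s, ε j • x j‖ = ρ) :
    ρ ^ 2 = ‖y‖ ^ 2 + ∑ j ∈ s, ‖x j‖ ^ 2 := by
  classical
  induction s using Finset.induction_on generalizing y with
  | empty => simpa using congrArg (· ^ 2) (h 1 (by simp)).symm
  | insert k s hk ih =>
    have hsign {a : ℝ} (ha : |a| = 1) : ρ ^ 2 = ‖y + a • x k‖ ^ 2 + ∑ j ∈ s, ‖x j‖ ^ 2 := by
      refine ih fun ε hε => ?_
      have hupdate := h (Function.update ε k a) fun j => by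
        by_cases hj : j = k <;> simp [hj, ha, hε]
      rw [Finset.sum_insert hk, Function.update_self, ← add_assoc] at hupdate
      rw [← hupdate]
      congr 2
      refine Finset.sum_congr rfl fun j hj => ?_
      rw [Function.update_of_ne (ne_of_mem_of_not_mem hj hk)]
    have hplus := hsign (a := 1) (by simp)
    have hminus := hsign (a := -1) (by simp)
    rw [one_smul] at hplus
    rw [neg_one_smul, ← sub_eq_add_neg] at hminus
    rw [Finset.sum_insert hk]
    linarith [parallelogram_law_with_norm ℝ y (x k)]

section TorusImage

variable {ι E : Type*} [Fintype ι] [NormedAddCommGroup E] [InnerProductSpace ℂ E]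
  {b b' : OrthonormalBasis ι ℂ E} {r r' : ι → ℝ} {P : ℙ ℂ E} {w : E}

/-- The image in projective space of the torus of the unit vectors whose coordinates in the basis
`b` have absolute values `r j`. -/
def torusImage (b : OrthonormalBasis ι ℂ E) (r : ι → ℝ) : Set (ℙ ℂ E) :=
  {P | ∃ w ∈ P.submodule, ‖w‖ = 1 ∧ ∀ j, ‖(inner ℂ (b j) w : ℂ)‖ = r j}

theorem mem_torusImage_iff (hw : ‖w‖ = 1) (hwP : w ∈ P.submodule) :
    P ∈ torusImage b r ↔ ∀ j, ‖(inner ℂ (b j) w : ℂ)‖ = r j := by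
  refine ⟨fun ⟨w', hw'P, hw', hr⟩ j => ?_, fun hr => ⟨w, hwP, hw, hr⟩⟩
  have hphase := eq_inner_smul_of_mem_submodule hw' hw'P hwP
  have hone : ‖(inner ℂ w' w : ℂ)‖ = 1 := by
    have h := congrArg norm hphase
    rwa [norm_smul, hw, hw', mul_one, eq_comm] at h
  rw [hphase, inner_smul_right, norm_mul, hone, one_mul, hr]

/-- The image contains the lines through `∑ ± r_j b_j`; average over the signs. -/
theorem sq_radius_eq_sum_of_torusImage_subset (hr : ∀ j, 0 ≤ r j) (hsum : ∑ j, r j ^ 2 = 1)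
    (hsub : torusImage b r ⊆ torusImage b' r') (i : ι) :
    r' i ^ 2 = ∑ j, r j ^ 2 * ‖(inner ℂ (b' i) (b j) : ℂ)‖ ^ 2 := by
  have hradius : ∀ ε : ι → ℝ, (∀ j, |ε j| = 1) →
      ‖(0 : ℂ) + ∑ j, ε j • ((r j : ℂ) * inner ℂ (b' i) (b j))‖ = r' i := by
    intro ε hε
    let w : E := ∑ j, ((ε j * r j : ℝ) : ℂ) • b j
    have hcoord : ∀ j, ‖(inner ℂ (b j) w : ℂ)‖ = r j := fun j => by
      rw [b.orthonormal.inner_right_fintype, Complex.norm_real, norm_mul, Real.norm_eq_abs, hε,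
        one_mul, Real.norm_of_nonneg (hr j)]
    have hw : ‖w‖ = 1 := by
      have h := b.sum_sq_norm_inner_right w
      simp only [hcoord, hsum] at h
      exact (pow_eq_one_iff_of_nonneg (norm_nonneg _) two_ne_zero).1 h.symm
    have hw0 : w ≠ 0 := norm_ne_zero_iff.1 (hw ▸ one_ne_zero)
    have hwP := (mem_submodule_iff hw0).2 rfl
    have h := (mem_torusImage_iff hw hwP).1 (hsub ((mem_torusImage_iff hw hwP).2 hcoord)) i
    simpa [w, inner_sum, inner_smul_right, mul_assoc] using h
  have haverage := sq_eq_norm_sq_add_sum_of_forall_sign Finset.univ hradius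
  simpa [mul_pow] using haverage

theorem radius_eq_of_torusImage_subset {a : ℝ} (ha : 0 ≤ a) (hsum : ∑ _j : ι, a ^ 2 = 1)
    (hr' : ∀ j, 0 ≤ r' j) (hsub : torusImage b (fun _ => a) ⊆ torusImage b' r') (i : ι) :
    r' i = a := by
  have h := sq_radius_eq_sum_of_torusImage_subset (fun _ => ha) hsum hsub i
  rw [← Finset.mul_sum, b.sum_sq_norm_inner_left, b'.norm_eq_one, one_pow, mul_one] at h
  exact (pow_left_inj₀ (hr' i) ha two_ne_zero).1 h

theorem forall_radius_eq_iff_of_torusImage_eq (hr : ∀ j, 0 < r j) (hr' : ∀ j, 0 < r' j)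
    (hsum : ∑ j, r j ^ 2 = 1) (hsum' : ∑ j, r' j ^ 2 = 1) (h : torusImage b r = torusImage b' r')
    (a : ℝ) : (∀ j, r j = a) ↔ ∀ j, r' j = a := by
  constructor
  · intro ha
    obtain rfl : r = fun _ => a := funext ha
    exact fun j => radius_eq_of_torusImage_subset (hr j).le hsum (fun i => (hr' i).le) h.le j
  · intro ha
    obtain rfl : r' = fun _ => a := funext ha
    exact fun j => radius_eq_of_torusImage_subset (hr' j).le hsum' (fun i => (hr i).le) h.ge j

theorem inner_basis_toricLift {V : Type*} [NormedAddCommGroup V] [NormedSpace ℝ V] (z : ι → ℂ)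
    (α : ι → V →L[ℝ] ℝ) (p : V) (k : ι) :
    (inner ℂ (b k) (toricLift b z α p) : ℂ) = z k * Complex.exp (α k p * Complex.I) := by
  rw [toricLift_apply, b.orthonormal.inner_right_fintype]

theorem IsToricDatum.exists_toricLift_eq_smul {V : Type*} [NormedAddCommGroup V]
    [NormedSpace ℝ V] [FiniteDimensional ℝ V] {z : ι → ℂ} {α : ι → V →L[ℝ] ℝ}
    (h : IsToricDatum z α) (hcard : Module.finrank ℝ V + 1 = Fintype.card ι)
    (hw : ∀ j, ‖(inner ℂ (b j) w : ℂ)‖ = ‖z j‖) : ∃ p, ∃ c : ℂ, toricLift b z α p = c • w := by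
  let θ : ι → ℝ := fun j => (inner ℂ (b j) w / z j : ℂ).arg
  have hθ : ∀ j, z j * Complex.exp (θ j * Complex.I) = inner ℂ (b j) w := fun j => by
    have hpolar := Complex.norm_mul_exp_arg_mul_I (inner ℂ (b j) w / z j)
    rw [norm_div, hw, div_self (norm_ne_zero_iff.2 (h.ne_zero j)), Complex.ofReal_one,
      one_mul] at hpolar
    rw [hpolar, mul_div_cancel₀ _ (h.ne_zero j)]
  let m : ℝ := ∑ k, ‖z k‖ ^ 2 * θ k
  obtain ⟨p, hp⟩ := h.exists_velocity hcard (θ := fun j => θ j - m) (by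
    simp only [mul_sub, Finset.sum_sub_distrib, ← Finset.sum_mul, h.sum_sq, one_mul, m, sub_self])
  refine ⟨p, Complex.exp (-(m * Complex.I)), ?_⟩
  rw [← b.sum_repr' w, toricLift_apply, Finset.smul_sum]
  refine Finset.sum_congr rfl fun j _ => ?_
  rw [hp, ← hθ, smul_smul, mul_left_comm, ← Complex.exp_add, Complex.ofReal_sub, sub_mul,
    neg_add_eq_sub]

end TorusImage

theorem IsToricDatum.range_eq_torusImage {z : Fin 3 → ℂ} {α : Fin 3 → (ℝ × ℝ) →L[ℝ] ℝ}
    (h : IsToricDatum z α) {b : OrthonormalBasis (Fin 3) ℂ C3} {u : Torus → CP2}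
    (hu : IsLift (onPlane u) Set.univ (toricLift b z α)) :
    Set.range u = torusImage b fun j => ‖z j‖ := by
  ext P
  constructor
  · rintro ⟨⟨x, y⟩, rfl⟩
    obtain ⟨x, rfl⟩ := QuotientAddGroup.mk_surjective x
    obtain ⟨y, rfl⟩ := QuotientAddGroup.mk_surjective y
    refine ⟨_, hu.mem_submodule (Set.mem_univ (x, y)), norm_toricLift b α _ h.sum_sq, fun j => ?_⟩
    rw [inner_basis_toricLift, norm_mul, Complex.norm_exp_ofReal_mul_I, mul_one]
  · rintro ⟨w, hwP, -, hw⟩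
    obtain ⟨p, c, hp⟩ := h.exists_toricLift_eq_smul (by simp) hw
    exact ⟨(p.1, p.2), eq_of_mem_submodule (hu.ne_zero (Set.mem_univ p))
      (hu.mem_submodule (Set.mem_univ p)) (hp ▸ Submodule.smul_mem _ c hwP)⟩

/-! ### Product tori -/

/-- The identification of unitary matrices with the linear isometries of `ℂ³`. -/
def unitaryIsometry : Matrix.unitaryGroup (Fin 3) ℂ ≃* (C3 ≃ₗᵢ[ℂ] C3) :=
  (Unitary.mapEquiv (StarMulEquiv.ofClass
    (Matrix.toEuclideanCLM (n := Fin 3) (𝕜 := ℂ)))).toMulEquiv.trans Unitary.linearIsometryEquiv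

theorem unitaryIsometry_mem_submodule_unitaryAct_iff (g : Matrix.unitaryGroup (Fin 3) ℂ) {P : CP2}
    {w : C3} : unitaryIsometry g w ∈ (unitaryAct g P).submodule ↔ w ∈ P.submodule :=
  toEuclideanLin_mem_submodule_projAct_iff _

theorem unitaryAct_image_torusImage (g : Matrix.unitaryGroup (Fin 3) ℂ)
    (b : OrthonormalBasis (Fin 3) ℂ C3) (r : Fin 3 → ℝ) :
    unitaryAct g '' torusImage b r = torusImage (b.map (unitaryIsometry g)) r := by
  ext P
  constructor
  · rintro ⟨Q, ⟨w, hwQ, hw, hr⟩, rfl⟩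
    refine ⟨_, (unitaryIsometry_mem_submodule_unitaryAct_iff g).2 hwQ, ?_, fun j => ?_⟩
    · rw [LinearIsometryEquiv.norm_map, hw]
    · rw [OrthonormalBasis.map_apply, LinearIsometryEquiv.inner_map_map, hr]
  · rintro ⟨w, hwP, hw, hr⟩
    obtain ⟨w, rfl⟩ := (unitaryIsometry g).surjective w
    rw [LinearIsometryEquiv.norm_map] at hw
    have hw0 : w ≠ 0 := norm_ne_zero_iff.1 (hw ▸ one_ne_zero)
    have hwQ := (mem_submodule_iff hw0).2 rfl
    refine ⟨Projectivization.mk ℂ w hw0, ⟨w, hwQ, hw, fun j => ?_⟩, ?_⟩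
    · rw [← hr, OrthonormalBasis.map_apply, LinearIsometryEquiv.inner_map_map]
    · exact eq_of_mem_submodule ((unitaryIsometry g).map_eq_zero_iff.not.2 hw0)
        ((unitaryIsometry_mem_submodule_unitaryAct_iff g).2 hwQ) hwP

theorem exists_basisFun_map_unitaryIsometry_eq (b : OrthonormalBasis (Fin 3) ℂ C3) :
    ∃ g, (EuclideanSpace.basisFun (Fin 3) ℂ).map (unitaryIsometry g) = b := by
  refine ⟨unitaryIsometry.symm ((EuclideanSpace.basisFun (Fin 3) ℂ).equiv b (Equiv.refl _)), ?_⟩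
  refine DFunLike.ext _ _ fun j => ?_
  rw [OrthonormalBasis.map_apply, MulEquiv.apply_symm_apply, OrthonormalBasis.equiv_apply_basis,
    Equiv.refl_apply]

theorem hopf_eq_iff {z : S5} {P : CP2} : hopf z = P ↔ (z : C3) ∈ P.submodule :=
  (mem_submodule_iff _).symm

theorem hopf_image_productTorus (r : Fin 3 → ℝ) :
    hopf '' productTorus r = torusImage (EuclideanSpace.basisFun (Fin 3) ℂ) r := by
  ext P
  constructor
  · rintro ⟨z, hz, rfl⟩
    exact ⟨z, hopf_eq_iff.1 rfl, norm_eq_of_mem_sphere z, fun j => by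
      rw [EuclideanSpace.basisFun_inner]
      exact hz j⟩
  · rintro ⟨w, hwP, hw, hr⟩
    refine ⟨⟨w, mem_sphere_zero_iff_norm.2 hw⟩, fun j => ?_, hopf_eq_iff.2 hwP⟩
    rw [← hr j, EuclideanSpace.basisFun_inner]

theorem toCircle_coe_two_pi (x : ℝ) :
    ((AddCircle.toCircle (x : AddCircle (2 * π)) : Circle) : ℂ) = Complex.exp (x * Complex.I) := by
  rw [AddCircle.toCircle_apply_mk, div_self Real.two_pi_pos.ne', one_mul, Circle.coe_exp]

theorem toLp_mem_submodule_expAct_diagonal (d : Fin 3 → ℂ) (t : ℝ) {P : CP2} {w : C3}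
    (hw : w ∈ P.submodule) : WithLp.toLp 2 (fun j => Complex.exp (t * d j) * w j) ∈
      (expAct (Matrix.diagonal d) t P).submodule := by
  have happly : Matrix.toEuclideanLin (NormedSpace.exp ((t : ℂ) • Matrix.diagonal d)) w =
      WithLp.toLp 2 fun j => Complex.exp (t * d j) * w j := by
    rw [← Matrix.diagonal_smul, Matrix.exp_diagonal, Matrix.toLpLin_apply]
    ext j
    simp only [Matrix.mulVec_diagonal, Pi.coe_exp, Pi.smul_apply, smul_eq_mul,
      Complex.exp_eq_exp_ℂ]
  exact happly ▸ (toEuclideanLin_mem_submodule_projAct_iff _).2 hw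

section ProductMap

variable {r : Fin 3 → ℝ} (hsum : ∑ j, r j ^ 2 = 1)

/-- The parametrization of the product torus modulo the circle action by the points whose last
coordinate is real. -/
def productPoint (x : Torus) : S5 :=
  ⟨WithLp.toLp 2 ![r 0 * (x.1.toCircle : ℂ), r 1 * (x.2.toCircle : ℂ), r 2], by
    simpa [EuclideanSpace.norm_eq, Fin.sum_univ_three, Circle.norm_coe] using hsum⟩

/-- The induced parametrization of the image of the product torus in `ℂP²`. -/
def productMap (x : Torus) : CP2 := hopf (productPoint hsum x)

theorem injective_productMap (hr : ∀ j, r j ≠ 0) : Function.Injective (productMap hsum) := by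
  intro x y hxy
  obtain ⟨a, ha⟩ := (Projectivization.mk_eq_mk_iff' ℂ _ _ _ _).1 hxy
  have hcoord : ∀ j, a * (productPoint hsum y : C3) j = (productPoint hsum x : C3) j := fun j =>
    congrArg (fun v : C3 => v j) ha
  have hne : ∀ j, (r j : ℂ) ≠ 0 := fun j => Complex.ofReal_ne_zero.2 (hr j)
  obtain rfl : a = 1 := mul_right_cancel₀ (hne 2) ((hcoord 2).trans (one_mul _).symm)
  have hfst : (r 0 * y.1.toCircle : ℂ) = r 0 * x.1.toCircle := (one_mul _).symm.trans (hcoord 0)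
  have hsnd : (r 1 * y.2.toCircle : ℂ) = r 1 * x.2.toCircle := (one_mul _).symm.trans (hcoord 1)
  have hinj := AddCircle.injective_toCircle Real.two_pi_pos.ne'
  exact Prod.ext (hinj (Circle.ext (mul_left_cancel₀ (hne 0) hfst.symm)))
    (hinj (Circle.ext (mul_left_cancel₀ (hne 1) hsnd.symm)))

theorem isHomogeneous_productMap : IsHomogeneous (productMap hsum) := by
  refine ⟨Matrix.diagonal ![Complex.I, 0, 0], Matrix.diagonal ![0, Complex.I, 0], ?_, ?_, ?_, ?_⟩
  · rw [Matrix.diagonal_conjTranspose, Matrix.diagonal_neg]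
    congr 1
    ext j
    fin_cases j <;> simp
  · rw [Matrix.diagonal_conjTranspose, Matrix.diagonal_neg]
    congr 1
    ext j
    fin_cases j <;> simp
  · intro x y t
    have hpoint : (productPoint hsum (x + t, y) : C3) =
        WithLp.toLp 2 fun j => Complex.exp (t * ![Complex.I, 0, 0] j) *
          (productPoint hsum (x, y) : C3) j := by
      ext j
      fin_cases j <;>
        simp [productPoint, AddCircle.toCircle_add, toCircle_coe_two_pi, mul_comm, mul_assoc]
    rw [productMap, hopf_eq_iff, hpoint]
    exact toLp_mem_submodule_expAct_diagonal _ t (hopf_eq_iff.1 rfl)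
  · intro x y t
    have hpoint : (productPoint hsum (x, y + t) : C3) =
        WithLp.toLp 2 fun j => Complex.exp (t * ![0, Complex.I, 0] j) *
          (productPoint hsum (x, y) : C3) j := by
      ext j
      fin_cases j <;>
        simp [productPoint, AddCircle.toCircle_add, toCircle_coe_two_pi, mul_comm, mul_assoc]
    rw [productMap, hopf_eq_iff, hpoint]
    exact toLp_mem_submodule_expAct_diagonal _ t (hopf_eq_iff.1 rfl)

theorem toricLift_eq_productPoint (p : ℝ × ℝ) :
    toricLift (EuclideanSpace.basisFun (Fin 3) ℂ) (fun j => r j) ![.fst ℝ ℝ ℝ, .snd ℝ ℝ ℝ, 0] p =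
      productPoint hsum (p.1, p.2) := by
  ext j
  fin_cases j <;> simp [toricLift_apply, productPoint, Fin.sum_univ_three, toCircle_coe_two_pi]

theorem exists_toricLift_productMap (hr : ∀ j, r j ≠ 0) :
    ∃ α, IsToricDatum (fun j => (r j : ℂ)) α ∧ IsLift (onPlane (productMap hsum)) Set.univ
      (toricLift (EuclideanSpace.basisFun (Fin 3) ℂ) (fun j => r j) α) := by
  have hz : ∑ j, ‖(r j : ℂ)‖ ^ 2 = 1 := by simpa using hsum
  let β : Fin 3 → (ℝ × ℝ) →L[ℝ] ℝ := ![.fst ℝ ℝ ℝ, .snd ℝ ℝ ℝ, 0]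
  refine ⟨balancedPhase (fun j => r j) β, ⟨fun j => Complex.ofReal_ne_zero.2 (hr j), hz,
    sum_sq_norm_mul_balancedPhase hz β, fun v hv => ?_⟩,
    isLift_toricLift_balancedPhase hz fun p => ?_⟩
  · have hβ : ∀ i j, β i v = β j v := fun i j => by
      have h := (hv i).trans (hv j).symm
      simpa only [balancedPhase, sub_apply, sub_left_inj] using h
    exact Prod.ext (hβ 0 2) (hβ 1 2)
  · rw [toricLift_eq_productPoint hsum]
    exact hopf_eq_iff.1 rfl

theorem range_productMap (hr : ∀ j, 0 < r j) :
    Set.range (productMap hsum) = hopf '' productTorus r := by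
  obtain ⟨α, h, hU⟩ := exists_toricLift_productMap hsum fun j => (hr j).ne'
  simp only [h.range_eq_torusImage hU, hopf_image_productTorus,
    Complex.norm_of_nonneg (hr _).le]

end ProductMap

theorem exists_unitaryAct_image_eq_torusImage (b : OrthonormalBasis (Fin 3) ℂ C3)
    (r : Fin 3 → ℝ) : ∃ g, unitaryAct g '' (hopf '' productTorus r) = torusImage b r := by
  obtain ⟨g, rfl⟩ := exists_basisFun_map_unitaryIsometry_eq b
  exact ⟨g, by rw [hopf_image_productTorus, unitaryAct_image_torusImage]⟩

end

end HSLTorus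

theorem mainTheorem4_general :
    (∀ u : HSLTorus.Torus → HSLTorus.CP2,
      HSLTorus.IsLagrangianImmersion (HSLTorus.onPlane u) → HSLTorus.IsHomogeneous u →
        HSLTorus.IsHamiltonianStationary u ∧
        (∃ (g : Matrix.unitaryGroup (Fin 3) ℂ) (r : Fin 3 → ℝ),
          (∀ i, 0 < r i) ∧ ∑ i, r i ^ 2 = 1 ∧
            Set.range u = HSLTorus.unitaryAct g '' (HSLTorus.hopf '' HSLTorus.productTorus r)) ∧
        (∀ (g : Matrix.unitaryGroup (Fin 3) ℂ) (r : Fin 3 → ℝ),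
          (∀ i, 0 < r i) → ∑ i, r i ^ 2 = 1 →
            Set.range u = HSLTorus.unitaryAct g '' (HSLTorus.hopf '' HSLTorus.productTorus r) →
              (HSLTorus.IsSpecialLagrangian u ↔ ∀ i, r i = 1 / √3) ∧
              (HSLTorus.IsMinimal u ↔ ∀ i, r i = 1 / √3))) ∧
    (∀ r : Fin 3 → ℝ, (∀ i, 0 < r i) → ∑ i, r i ^ 2 = 1 →
      ∃ u : HSLTorus.Torus → HSLTorus.CP2, HSLTorus.IsHomogeneousHSLTorus u ∧
        Function.Injective u ∧ Set.range u = HSLTorus.hopf '' HSLTorus.productTorus r) := by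
  refine ⟨fun u hL hu => ?_, fun r hr hsum => ?_⟩
  · obtain ⟨b, z, α, h, hU⟩ := hu.exists_toricLift hL
    have hz : ∀ j, 0 < ‖z j‖ := fun j => norm_pos_iff.2 (h.ne_zero j)
    have hrange := h.range_eq_torusImage hU
    refine ⟨h.isHamiltonianStationary hU, ?_, fun g r hr hsum hur => ?_⟩
    · obtain ⟨g, hg⟩ := HSLTorus.exists_unitaryAct_image_eq_torusImage b fun j => ‖z j‖
      exact ⟨g, _, hz, h.sum_sq, hrange.trans hg.symm⟩
    · rw [HSLTorus.hopf_image_productTorus, HSLTorus.unitaryAct_image_torusImage, hrange] at hur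
      have hiff := HSLTorus.forall_radius_eq_iff_of_torusImage_eq hz hr h.sum_sq hsum hur (1 / √3)
      exact ⟨(h.isSpecialLagrangian_iff hU).trans hiff, (h.isMinimal_iff hU).trans hiff⟩
  · have hr0 : ∀ j, r j ≠ 0 := fun j => (hr j).ne'
    obtain ⟨α, h, hU⟩ := HSLTorus.exists_toricLift_productMap hsum hr0
    exact ⟨HSLTorus.productMap hsum, ⟨h.isLagrangianImmersion hU, h.isHamiltonianStationary hU,
      HSLTorus.isHomogeneous_productMap hsum⟩, HSLTorus.injective_productMap hsum hr0,
      HSLTorus.range_productMap hsum hr⟩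

theorem mainTheorem4 :
    -- classification, and characterization of the special Lagrangian (minimal) tori
    (∀ u : HSLTorus.Torus → HSLTorus.CP2, HSLTorus.IsHomogeneousHSLTorus u →
      (∃ (g : Matrix.unitaryGroup (Fin 3) ℂ) (r : Fin 3 → ℝ),
        (∀ i, 0 < r i) ∧ ∑ i, r i ^ 2 = 1 ∧
          Set.range u = HSLTorus.unitaryAct g '' (HSLTorus.hopf '' HSLTorus.productTorus r)) ∧
      (∀ (g : Matrix.unitaryGroup (Fin 3) ℂ) (r : Fin 3 → ℝ),
        (∀ i, 0 < r i) → ∑ i, r i ^ 2 = 1 →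
          Set.range u = HSLTorus.unitaryAct g '' (HSLTorus.hopf '' HSLTorus.productTorus r) →
            (HSLTorus.IsSpecialLagrangian u ↔ ∀ i, r i = 1 / √3) ∧
            (HSLTorus.IsMinimal u ↔ ∀ i, r i = 1 / √3))) ∧
    -- all the product tori do occur, as embedded tori
    (∀ r : Fin 3 → ℝ, (∀ i, 0 < r i) → ∑ i, r i ^ 2 = 1 →
      ∃ u : HSLTorus.Torus → HSLTorus.CP2, HSLTorus.IsHomogeneousHSLTorus u ∧
        Function.Injective u ∧ Set.range u = HSLTorus.hopf '' HSLTorus.productTorus r) :=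
  ⟨fun u hu => (mainTheorem4_general.1 u hu.lagrangian hu.homogeneous).2, mainTheorem4_general.2⟩
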